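/- **Point defects in a planar crystal.** Let $G=\mathrm{Isom}(\mathbb R^2)=\mathbb R^2\rtimes \mathrm O(2)$ and $G_0=\mathbb R^2\rtimes\mathrm{SO}(2)$. Let $\Gamma\le G$ be a discrete cocompact subgroup (the symmetry group of a planar crystal), let $\mathbb A=\{v\in\mathbb R^2 : (v,1)\in\Gamma\}$ be its group of translations, let $C\le\mathrm{SO}(2)$ be the group of linear parts of the elements of $\Gamma\cap G_0$, and let $N=|C|$. Put $V=G/\Gamma$ (the space of ground states) and $Y=G_0/(\Gamma\cap G_0)$ (the order parameter space). For $X\subseteq\mathbb R^2$ let $\mathrm{Def}_{\mathbb R^2}(X)=[\mathbb R^2\setminus X,\,V]$ be the set of free homotopy classes of continuous maps. Then the following hold. 1. $\mathbb A$ is a lattice of rank $2$ spanning $\mathbb R^2$; $N\in\{1,2,3,4,6\}$ and $C\cong\mathbb Z/N$ is generated by the rotation by $2\pi/N$; after a suitable choice of the origin $\Gamma\cap G_0=\mathbb A\rtimes C$, so that $Y=(\mathbb R^2\rtimes\mathrm{SO}(2))/(\mathbb A\rtimes C)$. 2. Let $\tilde G=\mathbb R^2\rtimes\mathbb R$, where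 $\theta\in\mathbb R$ acts as the rotation $R_\theta$ by the angle $\theta$. Then $\tilde G$ is simply connected, and $(v,\theta)\mapsto(v,R_\theta)$ and the composite $\tilde G\to G_0\to Y$ are covering maps. For every $k>1$ and all base points, the projection induces an isomorphism $\pi_k(\tilde G)\cong\pi_k(Y)$; moreover $\pi_k(Y)\cong\pi_k(\mathbb R)$, where $\mathbb R$ is the universal cover of $\mathrm{SO}(2)$. 3. Let $a_1,a_2$ be any $\mathbb Z$-basis of $\mathbb A$. There is $M\in\mathrm{GL}_2(\mathbb Z)$ with $R_{2\pi/N}\,a_j=\sum_i M_{ij}a_i$ and $M^N=I_2$. Let $H=\mathbb Z^2\rtimes_M\mathbb Z$, where $k\in\mathbb Z$ acts on $\mathbb Z^2$ by $M^k$. There is an isomorphism $e$ from $H$ onto the preimage of $\Gamma$ in $\tilde G$ such that $e(n,0)=(n_1a_1+n_2a_2,\,0)$ for $n\in\mathbb Z^2$ and the $\mathbb R$-component of $e(n,k)$ is $2\pi k/N$. For $e(h)=(v,\theta)$ let $\rho_h$ be the loop $t\mapsto[(tv,R_{t\theta})]$, $0\le t\le1$, in $Y$. Then $h\mapsto[\rho_h]$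 is an isomorphism $H\cong\pi_1(Y)$ at the base point $[1]$ (the product of two classes of loops being traversed from right to left), and $\pi_1(Y,y)\cong H$ for every $y\in Y$. 4. Let $X\subseteq\mathbb R^2$ consist of $m\ge 0$ distinct points $p_1,\dots,p_m$. As sets (that is, in the sense of a bijection), $$\mathrm{Def}_{\mathbb R^2}(X)\;\cong\;\bigl(\text{conjugacy classes of }\mathbb Z^2\rtimes_M\mathbb Z\bigr)^m\times\begin{cases}1&\text{if }\Gamma\text{ contains an orientation-reversing isometry (a reflection or a glide reflection)},\\ \mathbb Z/2\mathbb Z&\text{otherwise.}\end{cases}$$ The two factors are realised as follows. (a) Let $\iota\colon Y\to V$ be the natural map and $\sigma\in G$ the reflection in the first coordinate axis. In the first case $[f]\mapsto[\iota f]$ is a bijection $[\mathbb R^2\setminus X,Y]\to\mathrm{Def}_{\mathbb R^2}(X)$. In the second case $([f],\varepsilon)\mapsto[\sigma^{\varepsilon}\cdot\iota f]$ is a bijection $[\mathbb R^2\setminus X,Y]\times\mathbb Z/2\mathbb Z\to\mathrm{Def}_{\mathbb R^2}(X)$. (b) There is a bijection $\Psi$ from $[\mathbb R^2\setminus X,Y]$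 onto the set of $m$-tuples of elements of $H$ modulo simultaneous conjugation (which, for $m=1$, is the set of conjugacy classes of $H$), such that if $\Psi([f])$ is the class of $(h_1,\dots,h_m)$, then for each $i$ the restriction of $f$ to any positively oriented circle centred at $p_i$ whose radius is smaller than the distance from $p_i$ to each of the other points is freely homotopic to $\rho_{h_i}$. -/

import Mathlib

open scoped Topology Topology.Homotopy unitInterval Matrix

noncomputable section

/-! ### Homotopy classes of maps -/

/-- Homotopy of continuous maps, as a setoid. -/
def homotopySetoid (X Y : Type) [TopologicalSpace X] [TopologicalSpace Y] : Setoid C(X, Y) :=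
  ⟨ContinuousMap.Homotopic, ContinuousMap.Homotopic.equivalence⟩

/-- The set `hTop[X, Y]` of (free) homotopy classes of continuous maps `X → Y`. -/
def HTop (X Y : Type) [TopologicalSpace X] [TopologicalSpace Y] : Type :=
  Quotient (homotopySetoid X Y)

/-- The homotopy class of a continuous map. -/
def HTop.mk {X Y : Type} [TopologicalSpace X] [TopologicalSpace Y] (f : C(X, Y)) : HTop X Y :=
  Quotient.mk (homotopySetoid X Y) f

/-- Post-composition `[f] ↦ [g ∘ f]`. -/
def HTop.post {X Y Z : Type} [TopologicalSpace X] [TopologicalSpace Y] [TopologicalSpace Z]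
    (g : C(Y, Z)) : HTop X Y → HTop X Z :=
  Quotient.lift (fun f : C(X, Y) => HTop.mk (g.comp f)) (fun _ _ h =>
    Quotient.sound (s := homotopySetoid X Z)
      (ContinuousMap.Homotopic.comp (ContinuousMap.Homotopic.refl g) h))

/-- Two loops (maps from `[0,1]` with equal end values) are freely homotopic: they are joined by a
homotopy through loops. -/
def FreelyHomotopic {Y : Type} [TopologicalSpace Y] (a b : C(I, Y)) : Prop :=
  ∃ H : C(I × I, Y), (∀ t, H (0, t) = a t) ∧ (∀ t, H (1, t) = b t) ∧ ∀ s, H (s, 0) = H (s, 1)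

/-- The image of an `N`-dimensional loop under a continuous map. -/
def GenLoop.push {N X Y : Type} [TopologicalSpace X] [TopologicalSpace Y] (g : C(X, Y)) {x : X}
    (l : GenLoop N X x) : GenLoop N Y (g x) :=
  ⟨g.comp l.1, fun y hy => congrArg g (l.2 y hy)⟩

/-! ### The isometry group of the plane -/

/-- A semidirect product of topological groups carries the product topology. -/
instance SemidirectProduct.instTopologicalSpace {N G : Type} [Group N] [Group G]
    [TopologicalSpace N] [TopologicalSpace G] (φ : G →* MulAut N) :
    TopologicalSpace (N ⋊[φ] G) :=
  TopologicalSpace.induced (fun g => (g.left, g.right)) inferInstance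

/-- The Euclidean plane. -/
abbrev Plane : Type := EuclideanSpace ℝ (Fin 2)

/-- The orthogonal group `O(2)`. -/
abbrev O2 : Type := Matrix.orthogonalGroup (Fin 2) ℝ

/-- The linear action of a matrix on the plane. -/
def matAct (R : Matrix (Fin 2) (Fin 2) ℝ) (v : Plane) : Plane := WithLp.toLp 2 (R *ᵥ v.ofLp)

theorem matAct_one (v : Plane) : matAct 1 v = v :=
  congrArg (WithLp.toLp 2) (Matrix.one_mulVec v.ofLp)

theorem matAct_mul (R S : Matrix (Fin 2) (Fin 2) ℝ) (v : Plane) :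
    matAct (R * S) v = matAct R (matAct S v) :=
  congrArg (WithLp.toLp 2) (Matrix.mulVec_mulVec v.ofLp R S).symm

theorem matAct_add (R : Matrix (Fin 2) (Fin 2) ℝ) (v w : Plane) :
    matAct R (v + w) = matAct R v + matAct R w :=
  congrArg (WithLp.toLp 2) (Matrix.mulVec_add R v.ofLp w.ofLp)

/-- The natural action of `O(2)` on the translation group `ℝ²`. -/
def orthAction : O2 →* MulAut (Multiplicative Plane) where
  toFun R :=
    { toFun := fun v => Multiplicative.ofAdd (matAct R.1 v.toAdd)
      invFun := fun v => Multiplicative.ofAdd (matAct (R⁻¹).1 v.toAdd)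
      left_inv := fun v => by
        have h : (R⁻¹).1 * R.1 = 1 := congrArg Subtype.val (inv_mul_cancel R)
        apply Multiplicative.toAdd.injective
        rw [toAdd_ofAdd, toAdd_ofAdd, ← matAct_mul, h, matAct_one]
      right_inv := fun v => by
        have h : R.1 * (R⁻¹).1 = 1 := congrArg Subtype.val (mul_inv_cancel R)
        apply Multiplicative.toAdd.injective
        rw [toAdd_ofAdd, toAdd_ofAdd, ← matAct_mul, h, matAct_one]
      map_mul' := fun v w => congrArg Multiplicative.ofAdd (matAct_add R.1 v.toAdd w.toAdd) }
  map_one' := MulEquiv.ext fun v => congrArg Multiplicative.ofAdd (matAct_one v.toAdd)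
  map_mul' R S :=
    MulEquiv.ext fun v => congrArg Multiplicative.ofAdd (matAct_mul R.1 S.1 v.toAdd)

/-- `Isom(ℝ²) = ℝ² ⋊ O(2)`; the pair `(v, R)` is the isometry `x ↦ v + R x`. -/
abbrev PlaneIsom : Type := Multiplicative Plane ⋊[orthAction] O2

/-- The isometry `x ↦ v + R x`. -/
def PlaneIsom.mk' (v : Plane) (R : O2) : PlaneIsom := ⟨Multiplicative.ofAdd v, R⟩

/-- The subgroup `ℝ² ⋊ SO(2)` of orientation preserving isometries. -/
def properIsom : Subgroup PlaneIsom where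
  carrier := {g | g.right.1.det = 1}
  one_mem' := by simp
  mul_mem' {a b} ha hb := by
    simp only [Set.mem_ofPred_eq] at ha hb ⊢
    simp [ha, hb]
  inv_mem' {a} ha := by
    simp only [Set.mem_ofPred_eq] at ha ⊢
    have h : (a.right⁻¹).1.det * a.right.1.det = 1 := by
      rw [← Matrix.det_mul, show (a.right⁻¹).1 * a.right.1 = 1 from
        congrArg Subtype.val (inv_mul_cancel a.right), Matrix.det_one]
    simpa [ha] using h

/-- The rotation by the angle `θ`. -/
def rot (θ : ℝ) : O2 :=
  ⟨!![Real.cos θ, -Real.sin θ; Real.sin θ, Real.cos θ], by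
    rw [Matrix.mem_orthogonalGroup_iff]
    ext i j
    fin_cases i <;> fin_cases j <;>
      simp [Matrix.mul_apply, Fin.sum_univ_two] <;>
      nlinarith [Real.sin_sq_add_cos_sq θ]⟩

theorem det_rot (θ : ℝ) : (rot θ).1.det = 1 := by
  simp only [rot, Matrix.det_fin_two_of]
  nlinarith [Real.sin_sq_add_cos_sq θ]

/-- The reflection in the first coordinate axis, as a plane isometry. -/
def axisReflection : PlaneIsom :=
  PlaneIsom.mk' 0 ⟨!![1, 0; 0, -1], by
    rw [Matrix.mem_orthogonalGroup_iff]
    ext i j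
    fin_cases i <;> fin_cases j <;> simp [Matrix.mul_apply, Fin.sum_univ_two]⟩

theorem SemidirectProduct.continuous_left' {N G : Type} [Group N] [Group G]
    [TopologicalSpace N] [TopologicalSpace G] (φ : G →* MulAut N) :
    Continuous (fun g : N ⋊[φ] G => g.left) :=
  continuous_fst.comp (continuous_induced_dom (f := fun g : N ⋊[φ] G => (g.left, g.right)))

theorem SemidirectProduct.continuous_right' {N G : Type} [Group N] [Group G]
    [TopologicalSpace N] [TopologicalSpace G] (φ : G →* MulAut N) :
    Continuous (fun g : N ⋊[φ] G => g.right) :=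
  continuous_snd.comp (continuous_induced_dom (f := fun g : N ⋊[φ] G => (g.left, g.right)))

theorem continuous_matAct : Continuous fun q : O2 × Plane => matAct q.1.1 q.2 := by
  unfold matAct
  refine (PiLp.continuous_toLp 2 _).comp ?_
  exact Continuous.matrix_mulVec (continuous_subtype_val.comp continuous_fst)
    ((PiLp.continuous_ofLp 2 _).comp continuous_snd)

instance : IsTopologicalGroup PlaneIsom where
  continuous_mul := by
    refine continuous_induced_rng.2 (Continuous.prodMk ?_ ?_)
    · have h := continuous_matAct.comp (Continuous.prodMk
        ((SemidirectProduct.continuous_right' orthAction).comp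
          (continuous_fst (X := PlaneIsom) (Y := PlaneIsom)))
        (continuous_toAdd.comp ((SemidirectProduct.continuous_left' orthAction).comp
          (continuous_snd (X := PlaneIsom) (Y := PlaneIsom)))))
      exact ((SemidirectProduct.continuous_left' orthAction).comp continuous_fst).mul
        (continuous_ofAdd.comp h)
    · exact ((SemidirectProduct.continuous_right' orthAction).comp continuous_fst).mul
        ((SemidirectProduct.continuous_right' orthAction).comp continuous_snd)
  continuous_inv := by
    have hr : Continuous fun g : PlaneIsom => g.right⁻¹ := by
      refine continuous_induced_rng.2 ?_
      exact (continuous_star.comp continuous_subtype_val).comp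
        (SemidirectProduct.continuous_right' orthAction)
    refine continuous_induced_rng.2 (Continuous.prodMk ?_ hr)
    exact continuous_ofAdd.comp (continuous_matAct.comp (hr.prodMk
      (continuous_toAdd.comp (SemidirectProduct.continuous_left' orthAction).inv)))

/-! ### The data of a planar crystal with symmetry group `Γ` -/

/-- The lattice `𝔸` of translations in `Γ`. -/
def translationLattice (Γ : Subgroup PlaneIsom) : AddSubgroup Plane where
  carrier := {v | PlaneIsom.mk' v 1 ∈ Γ}
  zero_mem' := Γ.one_mem
  add_mem' {a b} ha hb := by
    have h := Γ.mul_mem ha hb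
    have e : PlaneIsom.mk' a 1 * PlaneIsom.mk' b 1 = PlaneIsom.mk' (a + b) 1 := by
      ext <;> simp [PlaneIsom.mk']
    rw [e] at h
    exact h
  neg_mem' {a} ha := by
    have h := Γ.inv_mem ha
    have e : (PlaneIsom.mk' a 1)⁻¹ = PlaneIsom.mk' (-a) 1 := by
      ext <;> simp [PlaneIsom.mk']
    rw [e] at h
    exact h

/-- The rotation group `C`: the linear parts of the orientation preserving elements of `Γ`. -/
def rotationGroup (Γ : Subgroup PlaneIsom) : Subgroup O2 :=
  (Γ ⊓ properIsom).map SemidirectProduct.rightHom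

/-- The space `(ℝ² ⋊ SO(2)) / (Γ ∩ (ℝ² ⋊ SO(2)))`. -/
abbrev OrderSpace (Γ : Subgroup PlaneIsom) : Type := properIsom ⧸ Γ.subgroupOf properIsom

/-- The space `Isom(ℝ²) / Γ` of all ground states. -/
abbrev VacuumSpace (Γ : Subgroup PlaneIsom) : Type := PlaneIsom ⧸ Γ

/-- `Def_{ℝ²}(X)`: homotopy classes of maps from `ℝ² ∖ X` to the space of ground states. -/
abbrev Defects (Γ : Subgroup PlaneIsom) (X : Set Plane) : Type := HTop ↥(Xᶜ) (VacuumSpace Γ)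

/-- `Γ` contains an orientation reversing isometry (a reflection or a glide reflection). -/
def HasReflection (Γ : Subgroup PlaneIsom) : Prop := ∃ g ∈ Γ, g.right.1.det = -1

/-- The map from the order parameter space onto the component of the space of ground states
with chirality `ε`: the coset of `g` goes to the coset of `σ ^ ε * g`, where `σ` is a reflection. -/
def chiralMap (Γ : Subgroup PlaneIsom) (ε : ZMod 2) : C(OrderSpace Γ, VacuumSpace Γ) where
  toFun y := axisReflection ^ ε.val • Quotient.lift
    (fun g : properIsom => (QuotientGroup.mk (g : PlaneIsom) : VacuumSpace Γ))
    (fun a b h => by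
      rw [← Quotient.eq_iff_equiv] at h
      exact QuotientGroup.eq.2 (by simpa [Subgroup.mem_subgroupOf] using QuotientGroup.eq.1 h)) y
  continuous_toFun := by
    refine (continuous_const_smul _).comp ?_
    exact continuous_quot_lift _ (continuous_quot_mk.comp continuous_subtype_val)

/-! ### The universal cover -/

/-- Rotation as a homomorphism `ℝ → O(2)`; it is the universal cover of `SO(2)`. -/
def rotHom : Multiplicative ℝ →* O2 where
  toFun θ := rot θ.toAdd
  map_one' := by
    ext i j
    fin_cases i <;> fin_cases j <;> simp [rot]
  map_mul' a b := by
    ext i j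
    fin_cases i <;> fin_cases j <;>
      simp [rot, Real.cos_add, Real.sin_add] <;> ring

/-- The group `ℝ² ⋊ ℝ`, where `θ` acts as the rotation by the angle `θ`. -/
abbrev CoverGroup : Type := Multiplicative Plane ⋊[orthAction.comp rotHom] Multiplicative ℝ

/-- The element `(v, θ)` of `ℝ² ⋊ ℝ`. -/
def CoverGroup.mk' (v : Plane) (θ : ℝ) : CoverGroup :=
  ⟨Multiplicative.ofAdd v, Multiplicative.ofAdd θ⟩

/-- The homomorphism `(v, θ) ↦ (v, rot θ)` from `ℝ² ⋊ ℝ` to `ℝ² ⋊ SO(2)`. -/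
def coverHom : CoverGroup →* properIsom where
  toFun g := ⟨⟨g.left, rotHom g.right⟩, det_rot _⟩
  map_one' := Subtype.ext (by ext1 <;> simp)
  map_mul' a b := Subtype.ext (by ext1 <;> simp)

theorem continuous_rot : Continuous rot := by
  refine continuous_induced_rng.2 (continuous_matrix fun i j => ?_)
  fin_cases i <;> fin_cases j <;> simp [rot] <;> fun_prop

theorem continuous_coverHom : Continuous coverHom := by
  have h₁ := SemidirectProduct.continuous_left' (orthAction.comp rotHom)
  have h₂ : Continuous fun g : CoverGroup => rotHom g.right :=
    continuous_rot.comp (continuous_toAdd.comp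
      (SemidirectProduct.continuous_right' (orthAction.comp rotHom)))
  have h : Continuous fun g : CoverGroup => (⟨g.left, rotHom g.right⟩ : PlaneIsom) :=
    continuous_induced_rng.2 (h₁.prodMk h₂)
  exact h.subtype_mk _

/-- The projection `ℝ² ⋊ ℝ → ℝ² ⋊ SO(2) → (ℝ² ⋊ SO(2)) / (Γ ∩ (ℝ² ⋊ SO(2)))`. -/
def coverProj (Γ : Subgroup PlaneIsom) : C(CoverGroup, OrderSpace Γ) :=
  ⟨fun g => QuotientGroup.mk (coverHom g), continuous_quot_mk.comp continuous_coverHom⟩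

/-- The preimage of `Γ` in `ℝ² ⋊ ℝ`. -/
def liftedGroup (Γ : Subgroup PlaneIsom) : Subgroup CoverGroup :=
  (Γ.subgroupOf properIsom).comap coverHom

/-- The loop `t ↦ [(t v, rot (t θ))]` in the order parameter space belonging to the element
`(v, θ)` of the preimage of `Γ`. -/
def crystalLoop (Γ : Subgroup PlaneIsom) (γ : liftedGroup Γ) :
    Path (coverProj Γ 1) (coverProj Γ 1) where
  toFun t := coverProj Γ
    (CoverGroup.mk' ((t : ℝ) • γ.1.left.toAdd) ((t : ℝ) * γ.1.right.toAdd))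
  continuous_toFun := by
    refine (coverProj Γ).continuous.comp (continuous_induced_rng.2 (Continuous.prodMk ?_ ?_))
    · exact continuous_ofAdd.comp
        (continuous_subtype_val.smul continuous_const : Continuous fun t : I =>
          (t : ℝ) • γ.1.left.toAdd)
    · exact continuous_ofAdd.comp
        (continuous_subtype_val.mul continuous_const : Continuous fun t : I =>
          (t : ℝ) * γ.1.right.toAdd)
  source' := by
    congr 1
    ext1 <;> simp [CoverGroup.mk']
  target' := by
    have h : CoverGroup.mk' (((1 : I) : ℝ) • γ.1.left.toAdd) (((1 : I) : ℝ) * γ.1.right.toAdd)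
        = γ.1 := by
      ext1 <;> simp [CoverGroup.mk']
    rw [h]
    have hγ : coverHom γ.1 ∈ Γ.subgroupOf properIsom := γ.2
    exact QuotientGroup.eq.2 (by simpa using hγ)

/-! ### The groups `ℤ² ⋊_M ℤ` -/

/-- The natural action of `GL₂(ℤ)` on `ℤ²`. -/
def intAction : GL (Fin 2) ℤ →* MulAut (Multiplicative (Fin 2 → ℤ)) where
  toFun M :=
    { toFun := fun n => Multiplicative.ofAdd (M.1 *ᵥ n.toAdd)
      invFun := fun n => Multiplicative.ofAdd ((M⁻¹).1 *ᵥ n.toAdd)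
      left_inv := fun n => by
        have h : (M⁻¹).1 * M.1 = 1 := congrArg Units.val (inv_mul_cancel M)
        apply Multiplicative.toAdd.injective
        rw [toAdd_ofAdd, toAdd_ofAdd, Matrix.mulVec_mulVec, h, Matrix.one_mulVec]
      right_inv := fun n => by
        have h : M.1 * (M⁻¹).1 = 1 := congrArg Units.val (mul_inv_cancel M)
        apply Multiplicative.toAdd.injective
        rw [toAdd_ofAdd, toAdd_ofAdd, Matrix.mulVec_mulVec, h, Matrix.one_mulVec]
      map_mul' := fun v w =>
        congrArg Multiplicative.ofAdd (Matrix.mulVec_add M.1 v.toAdd w.toAdd) }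
  map_one' := MulEquiv.ext fun n => congrArg Multiplicative.ofAdd (Matrix.one_mulVec n.toAdd)
  map_mul' M M' := MulEquiv.ext fun n =>
    congrArg Multiplicative.ofAdd (Matrix.mulVec_mulVec n.toAdd M.1 M'.1).symm

/-- `ℤ² ⋊_M ℤ`, where `k ∈ ℤ` acts on `ℤ²` by `M ^ k`. -/
abbrev LatticeSemidirect (M : GL (Fin 2) ℤ) : Type :=
  Multiplicative (Fin 2 → ℤ) ⋊[zpowersHom _ (intAction M)] Multiplicative ℤ

/-- Simultaneous conjugacy of `m`-tuples of group elements. -/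
def simConj (H : Type) [Group H] (m : ℕ) : Setoid (Fin m → H) where
  r a b := ∃ h : H, ∀ i, b i = h * a i * h⁻¹
  iseqv :=
    { refl := fun _ => ⟨1, fun _ => by simp⟩
      symm := fun {a b} ⟨h, e⟩ => ⟨h⁻¹, fun i => by simp [e i, mul_assoc]⟩
      trans := fun {a b c} ⟨h, e⟩ ⟨k, e'⟩ => ⟨k * h, fun i => by simp [e i, e' i, mul_assoc]⟩ }

/-- The loop `f ∘ c` is freely homotopic to `l`, where `c` is any sufficiently small positively
oriented circle around the puncture `p i`. -/
def HasLoopAt {m : ℕ} {Y : Type} [TopologicalSpace Y] (p : Fin m → Plane) (i : Fin m)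
    (f : C(↥((Set.range p)ᶜ), Y)) (l : C(I, Y)) : Prop :=
  ∀ r : ℝ, 0 < r → (∀ j, j ≠ i → r < dist (p j) (p i)) →
    ∀ c : C(I, ↥((Set.range p)ᶜ)),
      (∀ t : I, (c t : Plane) =
        p i + r • !₂[Real.cos (2 * Real.pi * (t : ℝ)), Real.sin (2 * Real.pi * (t : ℝ))]) →
      FreelyHomotopic (f.comp c) l

end

noncomputable section

/-! ### The topological group `ℝ² ⋊ ℝ` -/

theorem matAct_zero (R : Matrix (Fin 2) (Fin 2) ℝ) : matAct R 0 = 0 :=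
  congrArg (WithLp.toLp 2) (Matrix.mulVec_zero R)

theorem matAct_smul (R : Matrix (Fin 2) (Fin 2) ℝ) (c : ℝ) (v : Plane) :
    matAct R (c • v) = c • matAct R v :=
  congrArg (WithLp.toLp 2) (Matrix.mulVec_smul R c v.ofLp)

/-- The linear action of a matrix as a linear map. -/
def matLin (R : Matrix (Fin 2) (Fin 2) ℝ) : Plane →ₗ[ℝ] Plane where
  toFun := matAct R
  map_add' := matAct_add R
  map_smul' := matAct_smul R

theorem matAct_sub (R : Matrix (Fin 2) (Fin 2) ℝ) (v w : Plane) :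
    matAct R (v - w) = matAct R v - matAct R w :=
  (matLin R).map_sub v w

theorem rot_zero : rot 0 = 1 := rotHom.map_one

theorem rot_add (a b : ℝ) : rot (a + b) = rot a * rot b :=
  rotHom.map_mul (Multiplicative.ofAdd a) (Multiplicative.ofAdd b)

theorem rot_neg (a : ℝ) : rot (-a) = (rot a)⁻¹ :=
  rotHom.map_inv (Multiplicative.ofAdd a)

theorem rot_zsmul (n : ℤ) (a : ℝ) : rot (n * a) = rot a ^ n := by
  rw [← zsmul_eq_mul]
  exact rotHom.map_zpow (Multiplicative.ofAdd a) n

namespace CoverGroup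

/-- The translation component. -/
def vec (g : CoverGroup) : Plane := g.left.toAdd

/-- The angle component. -/
def ang (g : CoverGroup) : ℝ := g.right.toAdd

theorem ext' {g h : CoverGroup} (h₁ : g.vec = h.vec) (h₂ : g.ang = h.ang) : g = h :=
  SemidirectProduct.ext h₁ h₂

@[simp] theorem vec_mk' (v : Plane) (θ : ℝ) : (mk' v θ).vec = v := rfl
@[simp] theorem ang_mk' (v : Plane) (θ : ℝ) : (mk' v θ).ang = θ := rfl
@[simp] theorem vec_one : (1 : CoverGroup).vec = 0 := rfl
@[simp] theorem ang_one : (1 : CoverGroup).ang = 0 := rfl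
theorem vec_mul (g h : CoverGroup) : (g * h).vec = g.vec + matAct (rot g.ang).1 h.vec := rfl
@[simp] theorem ang_mul (g h : CoverGroup) : (g * h).ang = g.ang + h.ang := rfl
@[simp] theorem ang_inv (g : CoverGroup) : (g⁻¹).ang = -g.ang := rfl
theorem vec_inv (g : CoverGroup) : (g⁻¹).vec = matAct (rot (-g.ang)).1 (-g.vec) := rfl

theorem continuous_vec : Continuous vec :=
  continuous_toAdd.comp (SemidirectProduct.continuous_left' _)

theorem continuous_ang : Continuous ang :=
  continuous_toAdd.comp (SemidirectProduct.continuous_right' _)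

theorem continuous_iff {X : Type*} [TopologicalSpace X] {f : X → CoverGroup} :
    Continuous f ↔ Continuous (fun x => (f x).vec) ∧ Continuous (fun x => (f x).ang) :=
  ⟨fun h => ⟨continuous_vec.comp h, continuous_ang.comp h⟩,
    fun h => continuous_induced_rng.2
      ((continuous_ofAdd.comp h.1).prodMk (continuous_ofAdd.comp h.2))⟩

theorem continuous_mk' : Continuous fun q : Plane × ℝ => mk' q.1 q.2 :=
  continuous_iff.2 ⟨continuous_fst, continuous_snd⟩

/-- The coordinates on `ℝ² ⋊ ℝ`. -/
def coords : CoverGroup ≃ₜ Plane × ℝ where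
  toFun g := (g.vec, g.ang)
  invFun q := mk' q.1 q.2
  left_inv _ := rfl
  right_inv _ := rfl
  continuous_toFun := continuous_vec.prodMk continuous_ang
  continuous_invFun := continuous_mk'

instance : ContractibleSpace CoverGroup := coords.contractibleSpace

theorem continuous_rotAct {X : Type*} [TopologicalSpace X] {f : X → ℝ} {g : X → Plane}
    (hf : Continuous f) (hg : Continuous g) : Continuous fun x => matAct (rot (f x)).1 (g x) :=
  continuous_matAct.comp ((continuous_rot.comp hf).prodMk hg)

theorem continuous_mul' : Continuous fun q : CoverGroup × CoverGroup => q.1 * q.2 := by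
  have h₁ : Continuous fun q : CoverGroup × CoverGroup => q.1.vec :=
    continuous_vec.comp continuous_fst
  have h₂ : Continuous fun q : CoverGroup × CoverGroup => q.2.vec :=
    continuous_vec.comp continuous_snd
  have h₃ : Continuous fun q : CoverGroup × CoverGroup => q.1.ang :=
    continuous_ang.comp continuous_fst
  have h₄ : Continuous fun q : CoverGroup × CoverGroup => q.2.ang :=
    continuous_ang.comp continuous_snd
  refine continuous_iff.2 ⟨?_, ?_⟩
  · simp only [vec_mul]
    exact h₁.add (continuous_rotAct h₃ h₂)
  · simp only [ang_mul]
    exact h₃.add h₄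

theorem continuous_inv' : Continuous fun g : CoverGroup => g⁻¹ := by
  refine continuous_iff.2 ⟨?_, ?_⟩
  · simp only [vec_inv]
    exact continuous_rotAct continuous_ang.neg continuous_vec.neg
  · simp only [ang_inv]
    exact continuous_ang.neg

instance : IsTopologicalGroup CoverGroup where
  continuous_mul := continuous_mul'
  continuous_inv := continuous_inv'

/-- Affine interpolation in the coordinates `(v, θ)`. -/
def lin (g h : CoverGroup) (t : ℝ) : CoverGroup :=
  mk' ((1 - t) • g.vec + t • h.vec) ((1 - t) * g.ang + t * h.ang)

theorem mul_lin (k g h : CoverGroup) (t : ℝ) : k * lin g h t = lin (k * g) (k * h) t := by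
  apply ext'
  · simp only [lin, vec_mul, vec_mk', matAct_add, matAct_smul]
    module
  · simp only [lin, ang_mul, ang_mk']
    ring

/-- An interpolation between group elements that commutes with right translations. -/
def interp (g h : CoverGroup) (t : ℝ) : CoverGroup := (lin g⁻¹ h⁻¹ t)⁻¹

theorem interp_mul (g h k : CoverGroup) (t : ℝ) :
    interp (g * k) (h * k) t = interp g h t * k := by
  simp only [interp, mul_inv_rev, ← mul_lin, inv_inv]

theorem interp_zero (g h : CoverGroup) : interp g h 0 = g := by
  have : lin g⁻¹ h⁻¹ 0 = g⁻¹ := ext' (by simp [lin]) (by simp [lin])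
  rw [interp, this, inv_inv]

theorem interp_one (g h : CoverGroup) : interp g h 1 = h := by
  have : lin g⁻¹ h⁻¹ 1 = h⁻¹ := ext' (by simp [lin]) (by simp [lin])
  rw [interp, this, inv_inv]

theorem interp_self (g : CoverGroup) (t : ℝ) : interp g g t = g := by
  have : lin g⁻¹ g⁻¹ t = g⁻¹ :=
    ext' (by simp only [lin, vec_mk']; module) (by simp only [lin, ang_mk']; ring)
  rw [interp, this, inv_inv]

theorem continuous_interp {X : Type*} [TopologicalSpace X] {f g : X → CoverGroup} {t : X → ℝ}
    (hf : Continuous f) (hg : Continuous g) (ht : Continuous t) :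
    Continuous fun x => interp (f x) (g x) (t x) := by
  have h : Continuous fun x => lin (f x)⁻¹ (g x)⁻¹ (t x) := by
    have h₁ := continuous_iff.1 hf.inv
    have h₂ := continuous_iff.1 hg.inv
    exact continuous_iff.2 ⟨((continuous_const.sub ht).smul h₁.1).add (ht.smul h₂.1),
      ((continuous_const.sub ht).mul h₁.2).add (ht.mul h₂.2)⟩
  exact h.inv

end CoverGroup

/-! ### Covering maps -/

theorem exists_rot_of_det_eq_one (R : O2) (h : R.1.det = 1) : ∃ θ, R = rot θ := by
  have hR := (Matrix.mem_orthogonalGroup_iff (Fin 2) ℝ).1 R.2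
  have hR' := (Matrix.mem_orthogonalGroup_iff' (Fin 2) ℝ).1 R.2
  have e₁ := congrFun (congrFun hR' 0) 0
  have e₂ := congrFun (congrFun hR' 0) 1
  have e₃ := congrFun (congrFun hR' 1) 1
  rw [Matrix.det_fin_two] at h
  simp [Matrix.mul_apply, Fin.sum_univ_two] at e₁ e₂ e₃
  set a := R.1 0 0
  set b := R.1 0 1
  set c := R.1 1 0
  set d := R.1 1 1
  have hd : d = a := by linear_combination (-d) * e₁ + c * e₂ + a * h
  have hb : b = -c := by linear_combination (-b) * e₁ + a * e₂ - c * h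
  have hn : ‖(⟨a, c⟩ : ℂ)‖ = 1 := by
    rw [Complex.norm_def, Real.sqrt_eq_one, Complex.normSq_apply]
    simpa using e₁
  have h0 : (⟨a, c⟩ : ℂ) ≠ 0 := by
    intro h0
    rw [h0, norm_zero] at hn
    exact zero_ne_one hn
  refine ⟨Complex.arg ⟨a, c⟩, ?_⟩
  have hc : Real.cos (Complex.arg ⟨a, c⟩) = a := by rw [Complex.cos_arg h0, hn]; simp
  have hs : Real.sin (Complex.arg ⟨a, c⟩) = c := by rw [Complex.sin_arg, hn]; simp
  ext i j
  fin_cases i <;> fin_cases j <;> simp [rot, hc, hs]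
  · rfl
  · exact hb
  · rfl
  · exact hd

theorem coverHom_surjective : Function.Surjective coverHom := by
  rintro ⟨g, hg⟩
  obtain ⟨θ, hθ⟩ := exists_rot_of_det_eq_one g.right hg
  refine ⟨CoverGroup.mk' g.left.toAdd θ, Subtype.ext ?_⟩
  exact SemidirectProduct.ext rfl hθ.symm

theorem rot_eq_one_iff (θ : ℝ) : rot θ = 1 ↔ ∃ n : ℤ, θ = n * (2 * Real.pi) := by
  constructor
  · intro h
    have h₁ := congrFun (congrFun (congrArg Subtype.val h) 0) 0
    simp [rot] at h₁
    obtain ⟨n, hn⟩ := (Real.cos_eq_one_iff θ).1 h₁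
    exact ⟨n, hn.symm⟩
  · rintro ⟨n, rfl⟩
    have : rot (2 * Real.pi) = 1 := by
      ext i j
      fin_cases i <;> fin_cases j <;> simp [rot]
    rw [rot_zsmul, this, one_zpow]

/-- If `θ` is small and `rot θ = 1` then `θ = 0`. -/
theorem eq_zero_of_rot_eq_one {θ : ℝ} (h : rot θ = 1) (hθ : |θ| < 1) : θ = 0 := by
  obtain ⟨n, rfl⟩ := (rot_eq_one_iff θ).1 h
  have h1 : |(n : ℝ)| < 1 := by
    rw [abs_mul] at hθ
    have : 1 ≤ |2 * Real.pi| := by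
      rw [abs_of_pos (by positivity)]
      linarith [Real.pi_gt_three]
    nlinarith [abs_nonneg (n : ℝ)]
  have : n = 0 := by
    rw [← Int.abs_lt_one_iff]
    exact_mod_cast h1
  simp [this]

theorem coverHom_eq_one {g : CoverGroup} (h : coverHom g = 1) (hθ : |g.ang| < 1) : g = 1 := by
  have h' : (coverHom g).1 = 1 := congrArg Subtype.val h
  refine CoverGroup.ext' ?_ ?_
  · exact congrArg SemidirectProduct.left h'
  · exact eq_zero_of_rot_eq_one (congrArg SemidirectProduct.right h') hθ

/-- The preimage of a discrete subgroup under `coverHom` is discrete. -/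
theorem isDiscrete_comap_coverHom (S : Subgroup properIsom) (hS : IsDiscrete (S : Set properIsom)) :
    IsDiscrete (S.comap coverHom : Set CoverGroup) := by
  constructor
  have h := hS.to_subtype
  change DiscreteTopology S at h
  obtain ⟨W, hW, hWS⟩ := isOpen_induced_iff.1 (isOpen_discrete ({1} : Set S))
  change DiscreteTopology (S.comap coverHom)
  refine discreteTopology_of_isOpen_singleton_one
    (isOpen_induced_iff.2 ⟨coverHom ⁻¹' W ∩ {g | |g.ang| < 1}, ?_, ?_⟩)
  · exact (hW.preimage continuous_coverHom).inter
      (isOpen_lt CoverGroup.continuous_ang.abs continuous_const)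
  · ext ⟨g, hg⟩
    simp only [Set.mem_preimage, Set.mem_inter_iff, Set.mem_ofPred_eq, Set.mem_singleton_iff]
    constructor
    · rintro ⟨h₁, h₂⟩
      have h₃ : (⟨coverHom g, hg⟩ : S) ∈ Subtype.val ⁻¹' W := h₁
      rw [hWS] at h₃
      exact Subtype.ext (coverHom_eq_one (congrArg Subtype.val h₃) h₂)
    · intro h₁
      have h₂ : g = 1 := congrArg Subtype.val h₁
      subst h₂
      refine ⟨?_, by simp⟩
      have h₃ : (1 : S) ∈ Subtype.val ⁻¹' W := by rw [hWS]; rfl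
      simpa using h₃

theorem rot_arcsin {R : O2} (h : R.1.det = 1) (h0 : 0 < R.1 0 0) :
    rot (Real.arcsin (R.1 1 0)) = R := by
  obtain ⟨θ, rfl⟩ := exists_rot_of_det_eq_one R h
  have hc : 0 < Real.cos θ := by simpa [rot] using h0
  have hs : Real.sin (Real.arcsin (Real.sin θ)) = Real.sin θ :=
    Real.sin_arcsin (Real.neg_one_le_sin θ) (Real.sin_le_one θ)
  have hc' : Real.cos (Real.arcsin (Real.sin θ)) = Real.cos θ := by
    rw [Real.cos_arcsin, ← Real.cos_sq', Real.sqrt_sq hc.le]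
  ext i j
  fin_cases i <;> fin_cases j <;> simp [rot, hs, hc']

theorem isOpenMap_coverHom : IsOpenMap coverHom := by
  refine IsTopologicalGroup.isOpenMap_iff_nhds_one.2 ?_
  have hr : Continuous fun g : properIsom => g.1.right.1 :=
    continuous_subtype_val.comp
      ((SemidirectProduct.continuous_right' orthAction).comp continuous_subtype_val)
  have hl : Continuous fun g : properIsom => g.1.left.toAdd :=
    continuous_toAdd.comp
      ((SemidirectProduct.continuous_left' orthAction).comp continuous_subtype_val)
  let s : properIsom → CoverGroup :=
    fun g => CoverGroup.mk' g.1.left.toAdd (Real.arcsin (g.1.right.1 1 0))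
  have hs : Continuous s :=
    CoverGroup.continuous_mk'.comp
      (hl.prodMk (Real.continuous_arcsin.comp (hr.matrix_elem 1 0)))
  have hs1 : s 1 = 1 := CoverGroup.ext' rfl (by simp [s])
  intro U hU
  have h₁ : s ⁻¹' (coverHom ⁻¹' U) ∈ 𝓝 (1 : properIsom) :=
    hs.continuousAt.preimage_mem_nhds (by rw [hs1]; exact hU)
  have h₂ : {g : properIsom | 0 < g.1.right.1 0 0} ∈ 𝓝 (1 : properIsom) :=
    (isOpen_lt continuous_const (hr.matrix_elem 0 0)).mem_nhds (by simp)
  filter_upwards [h₁, h₂] with g hg₁ hg₂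
  have : coverHom (s g) = g := Subtype.ext (SemidirectProduct.ext rfl (rot_arcsin g.2 hg₂))
  rw [← this]
  exact hg₁

theorem isQuotientMap_coverHom : Topology.IsQuotientMap coverHom :=
  isOpenMap_coverHom.isQuotientMap continuous_coverHom coverHom_surjective

theorem isCoveringMap_coverHom : IsCoveringMap coverHom := by
  refine (isQuotientMap_coverHom.isQuotientCoveringMap_of_isDiscrete_ker_monoidHom ?_).isCoveringMap
  exact isDiscrete_comap_coverHom ⊥ ⟨inferInstanceAs (DiscreteTopology (⊥ : Subgroup properIsom))⟩

section Crystal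

variable (Γ : Subgroup PlaneIsom)

theorem coverProj_eq_iff {a b : CoverGroup} :
    coverProj Γ a = coverProj Γ b ↔ a⁻¹ * b ∈ liftedGroup Γ := by
  refine QuotientGroup.eq.trans ?_
  rw [← map_inv, ← map_mul]
  rfl

theorem coverProj_mul (a : CoverGroup) (b : liftedGroup Γ) :
    coverProj Γ (a * b) = coverProj Γ a :=
  ((coverProj_eq_iff Γ).2 (by simp)).symm

theorem coverProj_surjective : Function.Surjective (coverProj Γ) :=
  QuotientGroup.mk_surjective.comp coverHom_surjective

theorem isCoveringMap_coverProj [DiscreteTopology Γ] : IsCoveringMap (coverProj Γ) := by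
  have hq : Topology.IsQuotientMap (coverProj Γ) :=
    (QuotientGroup.isOpenMap_coe.comp isOpenMap_coverHom).isQuotientMap (coverProj Γ).continuous
      (coverProj_surjective Γ)
  refine (hq.isQuotientCoveringMap_of_subgroupOp (liftedGroup Γ) ?_
    (coverProj_eq_iff Γ)).isCoveringMap
  refine isDiscrete_comap_coverHom _ ⟨?_⟩
  refine DiscreteTopology.of_continuous_injective (β := Γ)
    (f := fun g => ⟨g.1.1, g.2⟩) ?_ ?_
  · exact (continuous_subtype_val.comp continuous_subtype_val).subtype_mk _
  · intro a b h
    exact Subtype.ext (Subtype.ext (congrArg (fun g : Γ => g.1) h))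

/-- A continuous family of interpolations projects to a well-defined point. -/
theorem coverProj_interp_mul (g h : CoverGroup) (b : liftedGroup Γ) (t : ℝ) :
    coverProj Γ (CoverGroup.interp (g * b) (h * b) t) = coverProj Γ (CoverGroup.interp g h t) := by
  rw [CoverGroup.interp_mul, coverProj_mul]

end Crystal


/-! ### Planar crystallographic groups -/

namespace PlaneIsom

/-- The action of an isometry on the plane. -/
def act (g : PlaneIsom) (x : Plane) : Plane := g.left.toAdd + matAct g.right.1 x

theorem act_mul (g h : PlaneIsom) (x : Plane) : act (g * h) x = act g (act h x) := by
  change (g.left.toAdd + matAct g.right.1 h.left.toAdd) + matAct (g.right.1 * h.right.1) x = _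
  rw [matAct_mul, act, act, matAct_add, add_assoc]

theorem act_add (g : PlaneIsom) (x w : Plane) : act g (x + w) = act g x + matAct g.right.1 w := by
  rw [act, act, matAct_add, add_assoc]

theorem continuous_act (x : Plane) : Continuous fun g : PlaneIsom => act g x :=
  (continuous_toAdd.comp (SemidirectProduct.continuous_left' _)).add
    (continuous_matAct.comp ((SemidirectProduct.continuous_right' _).prodMk continuous_const))

theorem det_mul (g h : PlaneIsom) : (g * h).right.1.det = g.right.1.det * h.right.1.det :=
  Matrix.det_mul _ _

theorem det_eq (g : PlaneIsom) : g.right.1.det = 1 ∨ g.right.1.det = -1 := by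
  have h := congrArg Matrix.det ((Matrix.mem_orthogonalGroup_iff (Fin 2) ℝ).1 g.right.2)
  rw [Matrix.det_mul, Matrix.det_one] at h
  change _ * (g.right.1ᵀ).det = 1 at h
  rw [Matrix.det_transpose] at h
  exact mul_self_eq_one_iff.1 h

theorem det_inv (g : PlaneIsom) : (g⁻¹).right.1.det = g.right.1.det := by
  have h := det_mul g⁻¹ g
  rw [inv_mul_cancel] at h
  have h1 : (1 : PlaneIsom).right.1.det = 1 := Matrix.det_one
  rw [h1] at h
  rcases det_eq g with h' | h' <;> rw [h'] at h ⊢ <;> linarith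

end PlaneIsom

open PlaneIsom

theorem eq_zero_of_rot_fix {θ : ℝ} (hθ : rot θ ≠ 1) {v : Plane}
    (h : matAct (rot θ).1 v = v) : v = 0 := by
  have h0 := congrFun (congrArg WithLp.ofLp h) 0
  have h1 := congrFun (congrArg WithLp.ofLp h) 1
  simp [matAct, rot, dotProduct, Fin.sum_univ_two] at h0 h1
  have hc : Real.cos θ ≠ 1 := by
    intro hc
    apply hθ
    have hs : Real.sin θ = 0 := by
      have := Real.sin_sq_add_cos_sq θ
      rw [hc] at this
      nlinarith
    ext i j
    fin_cases i <;> fin_cases j <;> simp [rot, hc, hs]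
  have hcs := Real.sin_sq_add_cos_sq θ
  have hne : 2 - 2 * Real.cos θ ≠ 0 := fun h' => hc (by linarith)
  have e0 : v.ofLp 0 = 0 := by
    apply (mul_eq_zero.1 (_ : (2 - 2 * Real.cos θ) * v.ofLp 0 = 0)).resolve_left hne
    linear_combination (Real.cos θ - 1) * h0 + Real.sin θ * h1 - v.ofLp 0 * hcs
  have e1 : v.ofLp 1 = 0 := by
    apply (mul_eq_zero.1 (_ : (2 - 2 * Real.cos θ) * v.ofLp 1 = 0)).resolve_left hne
    linear_combination (-Real.sin θ) * h0 + (Real.cos θ - 1) * h1 - v.ofLp 1 * hcs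
  ext i
  fin_cases i
  · exact e0
  · exact e1

/-- The linear map `1 - rot θ`. -/
def oneSubRot (θ : ℝ) : Plane →ₗ[ℝ] Plane := LinearMap.id - matLin (rot θ).1

theorem oneSubRot_apply (θ : ℝ) (v : Plane) : oneSubRot θ v = v - matAct (rot θ).1 v := rfl

theorem oneSubRot_injective {θ : ℝ} (hθ : rot θ ≠ 1) : Function.Injective (oneSubRot θ) := by
  rw [injective_iff_map_eq_zero]
  intro v hv
  exact eq_zero_of_rot_fix hθ (sub_eq_zero.1 hv).symm

theorem oneSubRot_surjective {θ : ℝ} (hθ : rot θ ≠ 1) : Function.Surjective (oneSubRot θ) :=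
  LinearMap.injective_iff_surjective.1 (oneSubRot_injective hθ)

theorem matAct_rot_comm (a b : ℝ) (v : Plane) :
    matAct (rot a).1 (matAct (rot b).1 v) = matAct (rot b).1 (matAct (rot a).1 v) := by
  have h : (rot a).1 * (rot b).1 = (rot b).1 * (rot a).1 := by
    have h' : rot a * rot b = rot b * rot a := by rw [← rot_add, ← rot_add, add_comm]
    exact congrArg Subtype.val h'
  rw [← matAct_mul, h, matAct_mul]

theorem trace_matLin (R : Matrix (Fin 2) (Fin 2) ℝ) :
    LinearMap.trace ℝ Plane (matLin R) = R.trace := by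
  rw [LinearMap.trace_eq_matrix_trace ℝ (EuclideanSpace.basisFun (Fin 2) ℝ).toBasis]
  congr 1
  ext i j
  rw [LinearMap.toMatrix_apply]
  fin_cases i <;> fin_cases j <;> simp [matLin, matAct]

section Crystal

variable (Γ : Subgroup PlaneIsom)

theorem exists_dist_orbit_le [CompactSpace (PlaneIsom ⧸ Γ)] (o : Plane) :
    ∃ r : ℝ, ∀ x : Plane, ∃ γ ∈ Γ, ‖act γ o - x‖ ≤ r := by
  let B : ℕ → Set PlaneIsom := fun n => {g | ‖act g o‖ < n}
  have hB : ∀ n, IsOpen (B n) := fun n =>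
    isOpen_lt (continuous_act o).norm continuous_const
  obtain ⟨n, hn⟩ := (isCompact_univ (X := PlaneIsom ⧸ Γ)).elim_directed_cover
    (fun n => (QuotientGroup.mk : PlaneIsom → PlaneIsom ⧸ Γ) '' B n)
    (fun n => QuotientGroup.isOpenMap_coe _ (hB n))
    (by
      intro q _
      obtain ⟨g, rfl⟩ := QuotientGroup.mk_surjective q
      obtain ⟨n, hn⟩ := exists_nat_gt ‖act g o‖
      exact Set.mem_iUnion.2 ⟨n, g, hn, rfl⟩)
    (directed_of_isDirected_le fun i j hij => Set.image_mono fun g hg =>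
      lt_of_lt_of_le (show ‖act g o‖ < i from hg) (by exact_mod_cast hij))
  refine ⟨n, fun x => ?_⟩
  obtain ⟨k, hk, hkg⟩ := hn (Set.mem_univ (QuotientGroup.mk (PlaneIsom.mk' (-x) 1)))
  have hγ := QuotientGroup.eq.1 hkg.symm
  refine ⟨_, hγ, ?_⟩
  have e : PlaneIsom.mk' (-x) 1 * ((PlaneIsom.mk' (-x) 1)⁻¹ * k) = k := mul_inv_cancel_left _ _
  have hx : act k o = act ((PlaneIsom.mk' (-x) 1)⁻¹ * k) o - x := by
    conv_lhs => rw [← e, act_mul]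
    generalize act ((PlaneIsom.mk' (-x) 1)⁻¹ * k) o = y
    change -x + matAct 1 y = y - x
    rw [matAct_one]
    abel
  rw [← hx]
  exact (show ‖act k o‖ < n from hk).le

theorem sub_mem_translationLattice {x y : PlaneIsom} (hx : x ∈ Γ) (hy : y ∈ Γ)
    (h : x.right = y.right) : x.left.toAdd - y.left.toAdd ∈ translationLattice Γ := by
  have hm := Γ.mul_mem hx (Γ.inv_mem hy)
  have e : x * y⁻¹ = PlaneIsom.mk' (x.left.toAdd - y.left.toAdd) 1 := by
    rw [mul_inv_eq_iff_eq_mul]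
    refine SemidirectProduct.ext ?_ ?_
    · change x.left.toAdd = (x.left.toAdd - y.left.toAdd) + matAct 1 y.left.toAdd
      rw [matAct_one]
      abel
    · change x.right = 1 * y.right
      rw [h, one_mul]
  rw [e] at hm
  exact hm

theorem matAct_mem_translationLattice {γ : PlaneIsom} (hγ : γ ∈ Γ) {v : Plane}
    (hv : v ∈ translationLattice Γ) : matAct γ.right.1 v ∈ translationLattice Γ := by
  have h₁ : γ * PlaneIsom.mk' v 1 ∈ Γ := Γ.mul_mem hγ hv
  have h := sub_mem_translationLattice Γ h₁ hγ (mul_one γ.right)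
  have e : (γ * PlaneIsom.mk' v 1).left.toAdd - γ.left.toAdd = matAct γ.right.1 v :=
    add_sub_cancel_left _ _
  rwa [e] at h

/-- The real span of the translations. -/
def latticeSpan : Submodule ℝ Plane := Submodule.span ℝ (translationLattice Γ : Set Plane)

theorem matAct_mem_latticeSpan {γ : PlaneIsom} (hγ : γ ∈ Γ) {v : Plane}
    (hv : v ∈ latticeSpan Γ) : matAct γ.right.1 v ∈ latticeSpan Γ := by
  have h : latticeSpan Γ ≤ (latticeSpan Γ).comap (matLin γ.right.1) :=
    Submodule.span_le.2 fun w hw => Submodule.subset_span (matAct_mem_translationLattice Γ hγ hw)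
  exact h hv

theorem exists_center : ∃ o : Plane, ∀ γ ∈ Γ, γ.right.1.det = 1 → act γ o - o ∈ latticeSpan Γ := by
  by_cases hΓ : ∃ g ∈ Γ, g.right.1.det = 1 ∧ g.right ≠ 1
  · obtain ⟨g, hg, hdet, hne⟩ := hΓ
    obtain ⟨θ, hθ⟩ := exists_rot_of_det_eq_one _ hdet
    rw [hθ] at hne
    obtain ⟨o, ho⟩ := oneSubRot_surjective hne g.left.toAdd
    refine ⟨o, fun γ hγ hγdet => ?_⟩
    obtain ⟨φ, hφ⟩ := exists_rot_of_det_eq_one _ hγdet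
    have hc : (g * γ).right = (γ * g).right := by
      change g.right * γ.right = γ.right * g.right
      rw [hθ, hφ, ← rot_add, ← rot_add, add_comm]
    have hcomm := sub_mem_translationLattice Γ (Γ.mul_mem hg hγ) (Γ.mul_mem hγ hg) hc
    have hT : oneSubRot θ (act γ o - o) ∈ latticeSpan Γ := by
      refine Submodule.subset_span ?_
      have e : oneSubRot θ (act γ o - o) =
          -((g * γ).left.toAdd - (γ * g).left.toAdd) := by
        change _ = -((g.left.toAdd + matAct g.right.1 γ.left.toAdd) -
          (γ.left.toAdd + matAct γ.right.1 g.left.toAdd))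
        rw [← ho, act, hθ, hφ]
        simp only [oneSubRot_apply, matAct_sub, matAct_add]
        rw [matAct_rot_comm φ θ]
        abel
      rw [e]
      exact neg_mem hcomm
    have hres : ∀ w ∈ latticeSpan Γ, oneSubRot θ w ∈ latticeSpan Γ := fun w hw => by
      have := matAct_mem_latticeSpan Γ hg hw
      rw [hθ] at this
      exact sub_mem hw this
    have hsurj : Function.Surjective ((oneSubRot θ).restrict hres) := by
      refine LinearMap.injective_iff_surjective.1 fun a b hab => ?_
      exact Subtype.ext (oneSubRot_injective hne (congrArg Subtype.val hab))
    obtain ⟨u, hu⟩ := hsurj ⟨_, hT⟩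
    have : u.1 = act γ o - o := oneSubRot_injective hne (congrArg Subtype.val hu)
    rw [← this]
    exact u.2
  · push Not at hΓ
    refine ⟨0, fun γ hγ hdet => Submodule.subset_span ?_⟩
    have h := sub_mem_translationLattice Γ hγ Γ.one_mem (hΓ γ hγ hdet)
    have e : act γ 0 - 0 = γ.left.toAdd - (1 : PlaneIsom).left.toAdd := by
      rw [act, matAct_zero]
      simp
    rwa [e]

theorem latticeSpan_eq_top [CompactSpace (PlaneIsom ⧸ Γ)] : latticeSpan Γ = ⊤ := by
  by_contra hW
  obtain ⟨ℓ, hℓ, hℓW⟩ := Submodule.exists_le_ker_of_lt_top _ (lt_top_iff_ne_top.2 hW)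
  obtain ⟨o, ho⟩ := exists_center Γ
  obtain ⟨r, hr⟩ := exists_dist_orbit_le Γ o
  obtain ⟨c, hc⟩ : ∃ c : ℝ, ∀ γ ∈ Γ, |ℓ (act γ o)| ≤ c := by
    have h₁ : ∀ γ ∈ Γ, γ.right.1.det = 1 → ℓ (act γ o) = ℓ o := fun γ hγ hdet => by
      have := hℓW (ho γ hγ hdet)
      rw [LinearMap.mem_ker, map_sub] at this
      linarith
    by_cases hg : ∃ g ∈ Γ, g.right.1.det ≠ 1
    · obtain ⟨g, hg, hgdet⟩ := hg
      refine ⟨|ℓ o| + |ℓ (act g o)|, fun γ hγ => ?_⟩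
      by_cases hdet : γ.right.1.det = 1
      · rw [h₁ γ hγ hdet]
        linarith [abs_nonneg (ℓ (act g o))]
      · have hd : (g⁻¹ * γ).right.1.det = 1 := by
          rw [det_mul, det_inv, (det_eq g).resolve_left hgdet, (det_eq γ).resolve_left hdet]
          norm_num
        have hw := matAct_mem_latticeSpan Γ hg (ho _ (Γ.mul_mem (Γ.inv_mem hg) hγ) hd)
        have e : act γ o = act g o + matAct g.right.1 (act (g⁻¹ * γ) o - o) := by
          rw [← act_add, add_sub_cancel, ← act_mul, mul_inv_cancel_left]
        have hw' := hℓW hw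
        rw [LinearMap.mem_ker] at hw'
        rw [e, map_add, hw', add_zero]
        linarith [abs_nonneg (ℓ o)]
    · push Not at hg
      exact ⟨|ℓ o|, fun γ hγ => by rw [h₁ γ hγ (hg γ hγ)]⟩
  obtain ⟨v, hv⟩ : ∃ v, ℓ v ≠ 0 := by
    by_contra h
    push Not at h
    exact hℓ (LinearMap.ext h)
  let L := LinearMap.toContinuousLinearMap ℓ
  let t : ℝ := (‖L‖ * r + c + 1) / ℓ v
  obtain ⟨γ, hγ, hγr⟩ := hr (t • v)
  have hx : ℓ (t • v) = ‖L‖ * r + c + 1 := by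
    rw [map_smul, smul_eq_mul, div_mul_cancel₀ _ hv]
  have h₁ : |ℓ (act γ o - t • v)| ≤ ‖L‖ * r :=
    (L.le_opNorm (act γ o - t • v)).trans (mul_le_mul_of_nonneg_left hγr (norm_nonneg _))
  rw [map_sub, hx, abs_le] at h₁
  have h₂ := abs_le.1 (hc γ hγ)
  linarith [h₁.1]

instance [DiscreteTopology Γ] : DiscreteTopology (translationLattice Γ) := by
  refine DiscreteTopology.of_continuous_injective (β := Γ)
    (f := fun v => ⟨PlaneIsom.mk' v.1 1, v.2⟩) ?_ ?_
  · refine Continuous.subtype_mk (continuous_induced_rng.2 ?_) _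
    exact (continuous_ofAdd.comp continuous_subtype_val).prodMk continuous_const
  · intro a b h
    exact Subtype.ext (congrArg (fun g : Γ => g.1.left.toAdd) h)

/-- The matrix of the linear part of an element of `Γ` in a basis of the lattice. -/
def latticeMatrix (b : Module.Basis (Fin 2) ℤ (translationLattice Γ)) {γ : PlaneIsom} (hγ : γ ∈ Γ) :
    Matrix (Fin 2) (Fin 2) ℤ := fun i j =>
  b.repr ⟨matAct γ.right.1 (b j), matAct_mem_translationLattice Γ hγ (b j).2⟩ i

theorem latticeMatrix_spec (b : Module.Basis (Fin 2) ℤ (translationLattice Γ)) {γ : PlaneIsom}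
    (hγ : γ ∈ Γ) (j : Fin 2) :
    matAct γ.right.1 (b j) = ∑ i, latticeMatrix Γ b hγ i j • (b i : Plane) := by
  have h := b.sum_repr ⟨matAct γ.right.1 (b j), matAct_mem_translationLattice Γ hγ (b j).2⟩
  rw [Fin.sum_univ_two] at h ⊢
  exact (congrArg Subtype.val h).symm

variable [DiscreteTopology Γ] [CompactSpace (PlaneIsom ⧸ Γ)]

/-- The lattice of translations as a `ℤ`-submodule. -/
abbrev latticeModule : Submodule ℤ Plane := AddSubgroup.toIntSubmodule (translationLattice Γ)

instance : DiscreteTopology (latticeModule Γ) :=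
  inferInstanceAs (DiscreteTopology (translationLattice Γ))

instance : IsZLattice ℝ (latticeModule Γ) := ⟨latticeSpan_eq_top Γ⟩

theorem nonempty_lattice_basis : Nonempty (Module.Basis (Fin 2) ℤ (translationLattice Γ)) := by
  have h : Module.finrank ℤ (latticeModule Γ) = 2 := by
    rw [ZLattice.rank ℝ (latticeModule Γ)]
    simp
  have : Module.Free ℤ (latticeModule Γ) := ZLattice.module_free ℝ _
  have : Module.Finite ℤ (latticeModule Γ) := ZLattice.module_finite ℝ _
  exact ⟨Module.finBasisOfFinrankEq ℤ (latticeModule Γ) h⟩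

/-- A lattice basis is a real basis of the plane. -/
def realBasis (b : Module.Basis (Fin 2) ℤ (translationLattice Γ)) : Module.Basis (Fin 2) ℝ Plane :=
  Module.Basis.ofZLatticeBasis ℝ (latticeModule Γ) b

theorem realBasis_apply (b : Module.Basis (Fin 2) ℤ (translationLattice Γ)) (i : Fin 2) :
    realBasis Γ b i = b i :=
  Module.Basis.ofZLatticeBasis_apply ℝ (latticeModule Γ) b i

theorem toMatrix_realBasis (b : Module.Basis (Fin 2) ℤ (translationLattice Γ)) {γ : PlaneIsom}
    (hγ : γ ∈ Γ) : LinearMap.toMatrix (realBasis Γ b) (realBasis Γ b) (matLin γ.right.1) =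
      (latticeMatrix Γ b hγ).map (Int.castRingHom ℝ) := by
  ext i j
  rw [LinearMap.toMatrix_apply, realBasis_apply]
  change (realBasis Γ b).repr (matAct γ.right.1 (b j)) i = _
  rw [latticeMatrix_spec Γ b hγ j, map_sum]
  simp only [← realBasis_apply, map_zsmul, Module.Basis.repr_self]
  fin_cases i <;> simp [Fin.sum_univ_two]

theorem exists_int_two_cos {θ : ℝ} (h : rot θ ∈ rotationGroup Γ) :
    ∃ n : ℤ, 2 * Real.cos θ = n := by
  obtain ⟨γ, hγ, hγθ⟩ := h
  obtain ⟨b⟩ := nonempty_lattice_basis Γ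
  have h₁ := toMatrix_realBasis Γ b hγ.1
  have h₂ := LinearMap.trace_eq_matrix_trace ℝ (realBasis Γ b) (matLin γ.right.1)
  have h₃ : γ.right = rot θ := hγθ
  rw [h₁, trace_matLin, h₃] at h₂
  refine ⟨(latticeMatrix Γ b hγ.1).trace, ?_⟩
  simp [rot, Matrix.trace, Fin.sum_univ_two] at h₂ ⊢
  linarith

end Crystal


open PlaneIsom

section Crystal

variable (Γ : Subgroup PlaneIsom)

theorem mem_rotationGroup {R : O2} :
    R ∈ rotationGroup Γ ↔ ∃ v : Plane, PlaneIsom.mk' v R ∈ Γ ∧ R.1.det = 1 := by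
  constructor
  · rintro ⟨γ, hγ, rfl⟩
    exact ⟨γ.left.toAdd, hγ.1, hγ.2⟩
  · rintro ⟨v, hv, hR⟩
    exact ⟨_, ⟨hv, hR⟩, rfl⟩

theorem det_of_mem_rotationGroup {R : O2} (h : R ∈ rotationGroup Γ) : R.1.det = 1 := by
  obtain ⟨_, _, h⟩ := (mem_rotationGroup Γ).1 h
  exact h

/-- The group of angles of the rotations in the rotation group. -/
def angleGroup : AddSubgroup ℝ where
  carrier := {θ | rot θ ∈ rotationGroup Γ}
  zero_mem' := by
    simp only [Set.mem_ofPred_eq, rot_zero]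
    exact one_mem _
  add_mem' {a b} ha hb := by
    simp only [Set.mem_ofPred_eq, rot_add] at *
    exact mul_mem ha hb
  neg_mem' {a} ha := by
    simp only [Set.mem_ofPred_eq, rot_neg] at *
    exact inv_mem ha

theorem mem_angleGroup {θ : ℝ} : θ ∈ angleGroup Γ ↔ rot θ ∈ rotationGroup Γ := Iff.rfl

theorem orderOf_rot_two_pi_div {n : ℕ} (hn : 0 < n) : orderOf (rot (2 * Real.pi / n)) = n := by
  have hn' : (n : ℝ) ≠ 0 := by positivity
  have key : ∀ k : ℕ, rot (2 * Real.pi / n) ^ k = 1 ↔ n ∣ k := fun k => by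
    have h := rot_zsmul k (2 * Real.pi / n)
    rw [zpow_natCast] at h
    rw [← h, rot_eq_one_iff]
    constructor
    · rintro ⟨m, hm⟩
      have : ((k : ℤ) : ℝ) = (m * n : ℤ) := by
        have hpi : (2 * Real.pi) ≠ 0 := by positivity
        push_cast at hm ⊢
        field_simp at hm
        linarith
      have h' : (k : ℤ) = m * n := by exact_mod_cast this
      exact Int.natCast_dvd_natCast.1 ⟨m, by rw [h', mul_comm]⟩
    · rintro ⟨m, rfl⟩
      refine ⟨m, ?_⟩
      push_cast
      field_simp
  refine Nat.dvd_antisymm (orderOf_dvd_of_pow_eq_one ((key n).2 dvd_rfl)) ?_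
  exact (key _).1 (pow_orderOf_eq_one _)

variable [DiscreteTopology Γ] [CompactSpace (PlaneIsom ⧸ Γ)]

theorem angleGroup_small {θ : ℝ} (h : θ ∈ angleGroup Γ) (h0 : 0 < θ) : Real.pi / 3 ≤ θ := by
  by_contra hlt
  push Not at hlt
  obtain ⟨n, hn⟩ := exists_int_two_cos Γ h
  have h1 : Real.cos (Real.pi / 3) < Real.cos θ :=
    Real.cos_lt_cos_of_nonneg_of_le_pi h0.le (by linarith [Real.pi_pos]) hlt
  have h2 : Real.cos θ < Real.cos 0 :=
    Real.cos_lt_cos_of_nonneg_of_le_pi le_rfl (by linarith [Real.pi_pos]) h0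
  rw [Real.cos_pi_div_three] at h1
  rw [Real.cos_zero] at h2
  have h3 : (1 : ℝ) < n := by linarith
  have h4 : (n : ℝ) < 2 := by linarith
  have h3' : (1 : ℤ) < n := by exact_mod_cast h3
  have h4' : n < (2 : ℤ) := by exact_mod_cast h4
  omega

theorem exists_angleGroup_eq :
    ∃ n : ℕ, 0 < n ∧ angleGroup Γ = AddSubgroup.zmultiples (2 * Real.pi / n) := by
  have h2 : (2 * Real.pi) ∈ angleGroup Γ := by
    rw [mem_angleGroup, (rot_eq_one_iff _).2 ⟨1, by simp⟩]
    exact one_mem _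
  rcases (angleGroup Γ).dense_or_cyclic with hd | ⟨a, ha⟩
  · obtain ⟨θ, hθ, hm⟩ := hd.exists_between (show (0 : ℝ) < 1 from one_pos)
    have := angleGroup_small Γ hθ hm.1
    linarith [Real.pi_gt_three, hm.2]
  · rw [← AddSubgroup.zmultiples_eq_closure] at ha
    wlog hpos : 0 ≤ a generalizing a
    · exact this (-a) (by rw [ha, AddSubgroup.zmultiples_neg]) (by linarith)
    rw [ha] at h2
    obtain ⟨k, hk⟩ := h2
    simp only [zsmul_eq_mul] at hk
    have hk0 : 0 < k := by
      by_contra hk0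
      have : (k : ℝ) ≤ 0 := by exact_mod_cast not_lt.1 hk0
      nlinarith [Real.pi_pos]
    lift k to ℕ using hk0.le
    refine ⟨k, by exact_mod_cast hk0, ?_⟩
    have hk' : (k : ℝ) ≠ 0 := by
      have : 0 < k := by exact_mod_cast hk0
      positivity
    rw [ha, ← hk]
    push_cast
    congr 1
    field_simp

variable (N : ℕ) (hN : N = Nat.card (rotationGroup Γ))

include hN in
theorem rotationGroup_structure : 0 < N ∧
    angleGroup Γ = AddSubgroup.zmultiples (2 * Real.pi / N) ∧
    rotationGroup Γ = Subgroup.zpowers (rot (2 * Real.pi / N)) := by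
  obtain ⟨n, hn, hS⟩ := exists_angleGroup_eq Γ
  have hC : rotationGroup Γ = Subgroup.zpowers (rot (2 * Real.pi / n)) := by
    apply le_antisymm
    · intro R hR
      obtain ⟨θ, rfl⟩ := exists_rot_of_det_eq_one R (det_of_mem_rotationGroup Γ hR)
      have hθ : θ ∈ angleGroup Γ := hR
      rw [hS] at hθ
      obtain ⟨k, rfl⟩ := hθ
      exact ⟨k, by simp only [zsmul_eq_mul, rot_zsmul]⟩
    · rw [Subgroup.zpowers_le, ← mem_angleGroup, hS]
      exact AddSubgroup.mem_zmultiples _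
  have : N = n := by
    rw [hN, hC, Nat.card_zpowers, orderOf_rot_two_pi_div hn]
  subst this
  exact ⟨hn, hS, hC⟩

include hN in
theorem rotationGroup_card_mem : N ∈ ({1, 2, 3, 4, 6} : Set ℕ) := by
  obtain ⟨h0, hS, -⟩ := rotationGroup_structure Γ N hN
  have hm : 2 * Real.pi / N ∈ angleGroup Γ := by
    rw [hS]
    exact AddSubgroup.mem_zmultiples _
  have hN0 : (0 : ℝ) < N := by exact_mod_cast h0
  have h6 : N ≤ 6 := by
    have h := angleGroup_small Γ hm (by positivity)
    rw [div_le_div_iff₀ (by norm_num) hN0] at h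
    have : (N : ℝ) ≤ 6 := by nlinarith [Real.pi_pos]
    exact_mod_cast this
  have h5 : N ≠ 5 := by
    rintro rfl
    obtain ⟨n, hn⟩ := exists_int_two_cos Γ hm
    push_cast at hn
    have h1 : Real.cos (2 * Real.pi / 5) < Real.cos (Real.pi / 3) :=
      Real.cos_lt_cos_of_nonneg_of_le_pi (by positivity) (by linarith [Real.pi_pos])
        (by linarith [Real.pi_pos])
    have h2 : 0 < Real.cos (2 * Real.pi / 5) :=
      Real.cos_pos_of_mem_Ioo ⟨by linarith [Real.pi_pos], by linarith [Real.pi_pos]⟩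
    rw [Real.cos_pi_div_three] at h1
    have h3 : (0 : ℝ) < n := by linarith
    have h4 : (n : ℝ) < 1 := by linarith
    have h3' : (0 : ℤ) < n := by exact_mod_cast h3
    have h4' : n < (1 : ℤ) := by exact_mod_cast h4
    omega
  simp only [Set.mem_insert_iff, Set.mem_singleton_iff]
  omega

/-! ### The preimage of the symmetry group in the universal cover -/

omit [DiscreteTopology Γ] [CompactSpace (PlaneIsom ⧸ Γ)] in
theorem mem_liftedGroup {g : CoverGroup} :
    g ∈ liftedGroup Γ ↔ PlaneIsom.mk' g.vec (rot g.ang) ∈ Γ := Iff.rfl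

omit [DiscreteTopology Γ] [CompactSpace (PlaneIsom ⧸ Γ)] in
theorem mk'_zero_mem_liftedGroup {v : Plane} :
    CoverGroup.mk' v 0 ∈ liftedGroup Γ ↔ v ∈ translationLattice Γ := by
  rw [mem_liftedGroup, CoverGroup.vec_mk', CoverGroup.ang_mk', rot_zero]
  rfl

omit [DiscreteTopology Γ] [CompactSpace (PlaneIsom ⧸ Γ)] in
theorem sub_mem_of_ang_eq {g h : CoverGroup} (hg : g ∈ liftedGroup Γ) (hh : h ∈ liftedGroup Γ)
    (e : g.ang = h.ang) : g.vec - h.vec ∈ translationLattice Γ :=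
  sub_mem_translationLattice Γ ((mem_liftedGroup Γ).1 hg) ((mem_liftedGroup Γ).1 hh)
    (congrArg rot e)

omit [DiscreteTopology Γ] [CompactSpace (PlaneIsom ⧸ Γ)] in
theorem ang_mem_angleGroup {g : CoverGroup} (hg : g ∈ liftedGroup Γ) : g.ang ∈ angleGroup Γ :=
  (mem_rotationGroup Γ).2 ⟨_, (mem_liftedGroup Γ).1 hg, det_rot _⟩

/-- The rotation about `o`. -/
def rotAbout (o : Plane) (θ : ℝ) : CoverGroup := CoverGroup.mk' (o - matAct (rot θ).1 o) θ

theorem rotAbout_add (o : Plane) (a b : ℝ) :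
    rotAbout o (a + b) = rotAbout o a * rotAbout o b := by
  refine CoverGroup.ext' ?_ rfl
  simp only [rotAbout, CoverGroup.vec_mk', CoverGroup.vec_mul, CoverGroup.ang_mk', matAct_sub,
    rot_add]
  change _ - matAct ((rot a).1 * (rot b).1) o = _
  rw [matAct_mul]
  abel

/-- The rotations about `o` as a homomorphism. -/
def rotAboutHom (o : Plane) : Multiplicative ℝ →* CoverGroup where
  toFun θ := rotAbout o θ.toAdd
  map_one' := by
    refine CoverGroup.ext' ?_ rfl
    simp [rotAbout, rot_zero, matAct_one]
  map_mul' a b := rotAbout_add o a.toAdd b.toAdd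

theorem rotAbout_zpow (o : Plane) (θ : ℝ) (k : ℤ) : rotAbout o θ ^ k = rotAbout o (k * θ) := by
  rw [← zsmul_eq_mul]
  exact ((rotAboutHom o).map_zpow (Multiplicative.ofAdd θ) k).symm

include hN in
theorem exists_origin : ∃ o : Plane, rotAbout o (2 * Real.pi / N) ∈ liftedGroup Γ ∧
    ∀ (v : Plane) (R : O2), R.1.det = 1 →
      (PlaneIsom.mk' v R ∈ Γ ↔
        R ∈ rotationGroup Γ ∧ v - (o - matAct R.1 o) ∈ translationLattice Γ) := by
  obtain ⟨h0, hS, hC⟩ := rotationGroup_structure Γ N hN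
  obtain ⟨o, ho⟩ : ∃ o, rotAbout o (2 * Real.pi / N) ∈ liftedGroup Γ := by
    by_cases h1 : rot (2 * Real.pi / N) = 1
    · refine ⟨0, (mem_liftedGroup Γ).2 ?_⟩
      have : PlaneIsom.mk' (rotAbout 0 (2 * Real.pi / N)).vec
          (rot (rotAbout 0 (2 * Real.pi / N)).ang) = 1 := by
        refine SemidirectProduct.ext ?_ h1
        simp [rotAbout, matAct_zero, PlaneIsom.mk']
      rw [this]
      exact Γ.one_mem
    · have hm : rot (2 * Real.pi / N) ∈ rotationGroup Γ := by
        rw [hC]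
        exact Subgroup.mem_zpowers _
      obtain ⟨v, hv, -⟩ := (mem_rotationGroup Γ).1 hm
      obtain ⟨o, ho⟩ := oneSubRot_surjective h1 v
      refine ⟨o, (mem_liftedGroup Γ).2 ?_⟩
      rw [← ho] at hv
      exact hv
  refine ⟨o, ho, fun v R hR => ?_⟩
  have key : ∀ R ∈ rotationGroup Γ, PlaneIsom.mk' (o - matAct R.1 o) R ∈ Γ := fun R hR => by
    rw [hC] at hR
    obtain ⟨k, rfl⟩ := hR
    have h := (liftedGroup Γ).zpow_mem ho k
    rw [rotAbout_zpow, mem_liftedGroup] at h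
    simp only [rotAbout, CoverGroup.vec_mk', CoverGroup.ang_mk', rot_zsmul] at h
    exact h
  constructor
  · intro h
    have hm : R ∈ rotationGroup Γ := (mem_rotationGroup Γ).2 ⟨v, h, hR⟩
    exact ⟨hm, sub_mem_translationLattice Γ h (key R hm) rfl⟩
  · rintro ⟨hm, hv⟩
    have h := Γ.mul_mem (show PlaneIsom.mk' (v - (o - matAct R.1 o)) 1 ∈ Γ from hv) (key R hm)
    have e : PlaneIsom.mk' (v - (o - matAct R.1 o)) 1 * PlaneIsom.mk' (o - matAct R.1 o) R =
        PlaneIsom.mk' v R := by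
      refine SemidirectProduct.ext ?_ (one_mul R)
      change (v - (o - matAct R.1 o)) + matAct 1 (o - matAct R.1 o) = v
      rw [matAct_one]
      abel
    rwa [e] at h

end Crystal


/-! ### Higher homotopy groups -/

theorem subsingleton_homotopyGroup_of_contraction {N X : Type} [TopologicalSpace X] (x : X)
    (c : C(I × X, X)) (h₀ : ∀ y, c (0, y) = y) (h₁ : ∀ y, c (1, y) = x) (hx : ∀ t, c (t, x) = x) :
    Subsingleton (HomotopyGroup N X x) := by
  have key : ∀ l : GenLoop N X x, GenLoop.Homotopic l GenLoop.const := fun l =>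
    ⟨{ toFun := fun q => c (q.1, l q.2)
       continuous_toFun := by
        have := l.1.continuous
        exact c.continuous.comp (continuous_fst.prodMk (this.comp continuous_snd))
       map_zero_left := fun y => h₀ _
       map_one_left := fun y => h₁ _
       prop' := fun t y hy => by
        have e : l y = x := l.2 y hy
        change c (t, l y) = l y
        rw [e, hx] }⟩
  refine ⟨fun a b => ?_⟩
  induction a using Quotient.inductionOn with | _ a
  induction b using Quotient.inductionOn with | _ b
  exact Quotient.sound ((key a).trans (key b).symm)

/-- Interpolation towards a point, as a continuous map. -/
def interpTo (x : CoverGroup) : C(I × CoverGroup, CoverGroup) :=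
  ⟨fun q => CoverGroup.interp q.2 x q.1,
    CoverGroup.continuous_interp continuous_snd continuous_const
      (continuous_subtype_val.comp continuous_fst)⟩

theorem subsingleton_homotopyGroup_coverGroup (N : Type) (x : CoverGroup) :
    Subsingleton (HomotopyGroup N CoverGroup x) :=
  subsingleton_homotopyGroup_of_contraction x (interpTo x) (fun y => CoverGroup.interp_zero y x)
    (fun y => CoverGroup.interp_one y x) (fun t => CoverGroup.interp_self x t)

theorem subsingleton_homotopyGroup_real (N : Type) (x : ℝ) :
    Subsingleton (HomotopyGroup N ℝ x) :=
  subsingleton_homotopyGroup_of_contraction x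
    ⟨fun q => (1 - (q.1 : ℝ)) * q.2 + q.1 * x, by fun_prop⟩
    (fun y => by simp) (fun y => by simp) (fun t => by simp; ring)

/-- A map from a cube lifts through a covering map. -/
theorem IsCoveringMap.exists_lift_cube {N E X : Type} [TopologicalSpace E] [TopologicalSpace X]
    {p : E → X} (cov : IsCoveringMap p) (l : C(N → I, X)) (e : E) (he : l 0 = p e) :
    ∃ L : C(N → I, E), p ∘ L = l ∧ L 0 = e := by
  let H : C(I × (N → I), X) := ⟨fun q => l (fun i => q.1 * q.2 i), by fun_prop⟩
  have H0 : ∀ y, H (0, y) = p ((ContinuousMap.const (N → I) e) y) := fun y => by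
    simp only [H, ContinuousMap.coe_mk, zero_mul, ContinuousMap.const_apply, ← he]
    rfl
  let K := cov.liftHomotopy H (ContinuousMap.const _ e) H0
  refine ⟨K.comp ((ContinuousMap.const _ 1).prodMk (ContinuousMap.id _)), ?_, ?_⟩
  · funext y
    refine (congrFun (cov.liftHomotopy_lifts H (ContinuousMap.const _ e) H0) (1, y)).trans ?_
    simp [H]
  · have h := cov.const_of_comp (g := fun t : I => K (t, 0))
      (K.continuous.comp (continuous_id.prodMk continuous_const)) (fun s t => by
        have h := cov.liftHomotopy_lifts H (ContinuousMap.const _ e) H0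
        have h₁ := congrFun h (s, 0)
        have h₂ := congrFun h (t, 0)
        simp only [Function.comp_apply] at h₁ h₂
        change p (K (s, 0)) = p (K (t, 0))
        rw [h₁, h₂]
        simp [H]) 1 0
    exact h.trans (cov.liftHomotopy_zero H (ContinuousMap.const _ e) H0 0)

theorem IsCoveringMap.lift_eq_on_boundary {N E X : Type} [DecidableEq N] [Nontrivial N]
    [TopologicalSpace E] [TopologicalSpace X] {p : E → X} (cov : IsCoveringMap p) {x : X}
    (l : GenLoop N X x) (L : C(N → I, E)) (hL : p ∘ L = l) (y : N → I)
    (hy : y ∈ Cube.boundary N) : L y = L 0 := by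
  have face : ∀ (i : N) (ε : I), (ε = 0 ∨ ε = 1) → ∀ y z : N → I, y i = ε → z i = ε →
      L y = L z := fun i ε hε y z hyi hzi => by
    have hs : IsPreconnected (Set.range fun y : N → I => Function.update y i ε) :=
      isPreconnected_range (continuous_id.update i continuous_const)
    refine cov.constOn_of_comp hs L.continuous.continuousOn (fun a ha b hb => by
      obtain ⟨a, rfl⟩ := ha
      obtain ⟨b, rfl⟩ := hb
      have h₁ : ∀ a : N → I, p (L (Function.update a i ε)) = x := fun a => by
        refine (congrFun hL _).trans (l.2 _ ⟨i, ?_⟩)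
        simpa using hε
      rw [h₁, h₁]) ⟨y, by simp [← hyi]⟩ ⟨z, by simp [← hzi]⟩
  obtain ⟨i, hi⟩ := hy
  obtain ⟨j, hj⟩ := exists_ne i
  rw [face i (y i) hi y (Function.update 0 i (y i)) rfl (by simp)]
  exact face j 0 (Or.inl rfl) _ _ (by simp [Function.update_of_ne hj]) rfl

section Crystal

variable (Γ : Subgroup PlaneIsom) [DiscreteTopology Γ]

theorem subsingleton_homotopyGroup_orderSpace (N : Type) [DecidableEq N] [Nontrivial N]
    (x : CoverGroup) : Subsingleton (HomotopyGroup N (OrderSpace Γ) (coverProj Γ x)) := by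
  have cov := isCoveringMap_coverProj Γ
  have key : ∀ l : GenLoop N (OrderSpace Γ) (coverProj Γ x),
      GenLoop.Homotopic l GenLoop.const := fun l => by
    obtain ⟨i⟩ : Nonempty N := inferInstance
    obtain ⟨L, hL, hL0⟩ := cov.exists_lift_cube l.1 x (l.2 0 ⟨i, Or.inl rfl⟩)
    have hb : ∀ y ∈ Cube.boundary N, L y = x := fun y hy =>
      (cov.lift_eq_on_boundary l L hL y hy).trans hL0
    exact ⟨{
      toFun := fun q => coverProj Γ (CoverGroup.interp (L q.2) x q.1)
      continuous_toFun := (coverProj Γ).continuous.comp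
        (CoverGroup.continuous_interp (L.continuous.comp continuous_snd) continuous_const
          (continuous_subtype_val.comp continuous_fst))
      map_zero_left := fun y =>
        (congrArg (coverProj Γ) (CoverGroup.interp_zero _ _)).trans (congrFun hL y)
      map_one_left := fun y => congrArg (coverProj Γ) (CoverGroup.interp_one _ _)
      prop' := fun t y hy => by
        change coverProj Γ (CoverGroup.interp (L y) x t) = l y
        rw [hb y hy, CoverGroup.interp_self]
        exact (l.2 y hy).symm }⟩
  refine ⟨fun a b => ?_⟩
  induction a using Quotient.inductionOn with | _ a
  induction b using Quotient.inductionOn with | _ b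
  exact Quotient.sound ((key a).trans (key b).symm)

theorem homotopyGroup_coverProj (k : ℕ) (x : CoverGroup) :
    (∃ φ : HomotopyGroup.Pi (k + 2) CoverGroup x ≃*
        HomotopyGroup.Pi (k + 2) (OrderSpace Γ) (coverProj Γ x),
      ∀ l : GenLoop (Fin (k + 2)) CoverGroup x,
        φ (Quotient.mk (GenLoop.Homotopic.setoid _ _) l) =
          Quotient.mk (GenLoop.Homotopic.setoid _ _) (GenLoop.push (coverProj Γ) l)) ∧
    Nonempty (HomotopyGroup.Pi (k + 2) (OrderSpace Γ) (coverProj Γ x) ≃*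
      HomotopyGroup.Pi (k + 2) ℝ x.right.toAdd) := by
  have s₁ := subsingleton_homotopyGroup_coverGroup (Fin (k + 2)) x
  have s₂ := subsingleton_homotopyGroup_orderSpace Γ (Fin (k + 2)) x
  have s₃ := subsingleton_homotopyGroup_real (Fin (k + 2)) x.right.toAdd
  have u₁ : Unique (HomotopyGroup.Pi (k + 2) CoverGroup x) := Unique.mk' _
  have u₂ : Unique (HomotopyGroup.Pi (k + 2) (OrderSpace Γ) (coverProj Γ x)) := Unique.mk' _
  have u₃ : Unique (HomotopyGroup.Pi (k + 2) ℝ x.right.toAdd) := Unique.mk' _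
  exact ⟨⟨MulEquiv.ofUnique, fun l => Subsingleton.elim _ _⟩, ⟨MulEquiv.ofUnique⟩⟩

/-! ### The fundamental group -/

omit [DiscreteTopology Γ] in
/-- The path `t ↦ (t v, t θ)` from `1` to `(v, θ)`. -/
def stdPath (g : CoverGroup) : Path 1 g where
  toFun t := CoverGroup.mk' ((t : ℝ) • g.vec) ((t : ℝ) * g.ang)
  continuous_toFun := CoverGroup.continuous_iff.2
    ⟨continuous_subtype_val.smul continuous_const, continuous_subtype_val.mul continuous_const⟩
  source' := CoverGroup.ext' (by simp) (by simp)
  target' := CoverGroup.ext' (by simp) (by simp)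

omit [DiscreteTopology Γ] in
theorem homotopic_of_lifts {x y : OrderSpace Γ} (p q : Path x y) (P Q : C(I, CoverGroup))
    (hP : ∀ t, coverProj Γ (P t) = p t) (hQ : ∀ t, coverProj Γ (Q t) = q t)
    (h₀ : P 0 = Q 0) (h₁ : P 1 = Q 1) : p.Homotopic q :=
  ⟨{ toFun := fun z => coverProj Γ (CoverGroup.interp (P z.2) (Q z.2) z.1)
     continuous_toFun := (coverProj Γ).continuous.comp
        (CoverGroup.continuous_interp (P.continuous.comp continuous_snd)
          (Q.continuous.comp continuous_snd) (continuous_subtype_val.comp continuous_fst))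
     map_zero_left := fun t =>
      (congrArg (coverProj Γ) (CoverGroup.interp_zero _ _)).trans (hP t)
     map_one_left := fun t =>
      (congrArg (coverProj Γ) (CoverGroup.interp_one _ _)).trans (hQ t)
     prop' := fun s t ht => by
      change coverProj Γ (CoverGroup.interp (P t) (Q t) s) = p t
      rw [← hP]
      rcases ht with rfl | rfl
      · rw [← h₀, CoverGroup.interp_self]
      · rw [← h₁, CoverGroup.interp_self] }⟩

/-- The class of the loop belonging to an element of the preimage of `Γ`. -/
def loopClass (γ : liftedGroup Γ) : FundamentalGroup (OrderSpace Γ) (coverProj Γ 1) :=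
  FundamentalGroup.fromPath (Path.Homotopic.Quotient.mk (crystalLoop Γ γ))

omit [DiscreteTopology Γ] in
theorem loopClass_mul (γ δ : liftedGroup Γ) :
    loopClass Γ (γ * δ) = loopClass Γ γ * loopClass Γ δ := by
  rw [FundamentalGroup.mul_def]
  change Path.Homotopic.Quotient.mk _ =
    (Path.Homotopic.Quotient.mk _).trans (Path.Homotopic.Quotient.mk _)
  rw [← Path.Homotopic.Quotient.mk_trans, Path.Homotopic.Quotient.eq]
  let Q : Path δ.1 (γ * δ).1 :=
    { toFun := fun t => stdPath γ.1 t * δ.1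
      continuous_toFun := (stdPath γ.1).continuous.mul continuous_const
      source' := by simp
      target' := by simp }
  refine homotopic_of_lifts Γ _ _ (stdPath (γ * δ).1).toContinuousMap
    ((stdPath δ.1).trans Q).toContinuousMap (fun t => rfl) (fun t => ?_) (by simp) (by simp)
  simp only [Path.trans_apply, Path.coe_toContinuousMap]
  split_ifs
  · rfl
  · exact coverProj_mul Γ _ δ

theorem loopClass_injective : Function.Injective (loopClass Γ) := by
  intro γ δ h
  have cov := isCoveringMap_coverProj Γ
  have h' := (Path.Homotopic.Quotient.eq (p := crystalLoop Γ γ) (q := crystalLoop Γ δ)).1 h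
  have h₁ := cov.liftPath_apply_one_eq_of_homotopicRel h' 1 (crystalLoop Γ γ).source
    (crystalLoop Γ δ).source
  have e : ∀ γ : liftedGroup Γ, (stdPath γ.1).toContinuousMap =
      cov.liftPath (crystalLoop Γ γ) 1 (crystalLoop Γ γ).source := fun γ =>
    (cov.eq_liftPath_iff' _).2 ⟨rfl, (stdPath γ.1).source⟩
  have h₂ := (congrArg (fun P => P 1) (e γ)).trans (h₁.trans (congrArg (fun P => P 1) (e δ)).symm)
  refine Subtype.ext ?_
  simpa using h₂

theorem loopClass_surjective : Function.Surjective (loopClass Γ) := by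
  intro q
  have cov := isCoveringMap_coverProj Γ
  induction q using Path.Homotopic.Quotient.ind with | mk p
  let P := cov.liftPath p.toContinuousMap 1 p.source
  have hP : ∀ t, coverProj Γ (P t) = p t := congrFun (cov.liftPath_lifts _ 1 p.source)
  have hP0 : P 0 = 1 := cov.liftPath_zero _ 1 p.source
  have hP1 : P 1 ∈ liftedGroup Γ := by
    have := (coverProj_eq_iff Γ).1 ((hP 1).trans p.target).symm
    simpa using this
  refine ⟨⟨P 1, hP1⟩, (Path.Homotopic.Quotient.eq).2 ?_⟩
  exact homotopic_of_lifts Γ _ _ (stdPath (P 1)).toContinuousMap P (fun t => rfl) hP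
    (by simp [hP0]) (by simp)

/-- The fundamental group of the order parameter space is the preimage of `Γ`. -/
def loopClassEquiv : liftedGroup Γ ≃* FundamentalGroup (OrderSpace Γ) (coverProj Γ 1) :=
  MulEquiv.ofBijective (MonoidHom.mk' (loopClass Γ) (loopClass_mul Γ))
    ⟨loopClass_injective Γ, loopClass_surjective Γ⟩

omit [DiscreteTopology Γ] in
theorem pathConnectedSpace_orderSpace : PathConnectedSpace (OrderSpace Γ) :=
  (coverProj_surjective Γ).pathConnectedSpace (coverProj Γ).continuous

omit [DiscreteTopology Γ] in
/-- Two loops with lifts having the same monodromy are freely homotopic. -/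
theorem freelyHomotopic_of_lifts (a b : C(I, OrderSpace Γ)) (P Q : C(I, CoverGroup))
    (hP : ∀ t, coverProj Γ (P t) = a t) (hQ : ∀ t, coverProj Γ (Q t) = b t)
    (γ : liftedGroup Γ) (h₁ : P 1 = P 0 * γ) (h₂ : Q 1 = Q 0 * γ) : FreelyHomotopic a b := by
  refine ⟨⟨fun z => coverProj Γ (CoverGroup.interp (P z.2) (Q z.2) z.1),
    (coverProj Γ).continuous.comp
        (CoverGroup.continuous_interp (P.continuous.comp continuous_snd)
          (Q.continuous.comp continuous_snd) (continuous_subtype_val.comp continuous_fst))⟩,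
    fun t => ?_, fun t => ?_, fun s => ?_⟩
  · exact (congrArg (coverProj Γ) (CoverGroup.interp_zero _ _)).trans (hP t)
  · exact (congrArg (coverProj Γ) (CoverGroup.interp_one _ _)).trans (hQ t)
  · change coverProj Γ (CoverGroup.interp (P 0) (Q 0) s) =
      coverProj Γ (CoverGroup.interp (P 1) (Q 1) s)
    rw [h₁, h₂, coverProj_interp_mul]

omit [DiscreteTopology Γ] in
theorem freelyHomotopic_crystalLoop (a : C(I, OrderSpace Γ)) (P : C(I, CoverGroup))
    (hP : ∀ t, coverProj Γ (P t) = a t) (γ : liftedGroup Γ) (h : P 1 = P 0 * γ) :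
    FreelyHomotopic a (crystalLoop Γ γ : C(I, OrderSpace Γ)) :=
  freelyHomotopic_of_lifts Γ a _ P (stdPath γ.1).toContinuousMap hP (fun _ => rfl) γ h (by simp)

end Crystal


/-! ### The group `ℤ² ⋊_M ℤ` as the preimage of the symmetry group -/

theorem MulAut.map_zpow_apply_of_semiconj {X Y : Type*} [Group X] [Group Y] (f : X →* Y)
    (A : MulAut X) (B : MulAut Y) (h : ∀ x, f (A x) = B (f x)) (k : ℤ) (x : X) :
    f ((A ^ k) x) = (B ^ k) (f x) := by
  have h' : ∀ x, f (A⁻¹ x) = B⁻¹ (f x) := fun x => by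
    rw [MulAut.inv_apply, MulAut.inv_apply, eq_comm, MulEquiv.symm_apply_eq, ← h,
      MulEquiv.apply_symm_apply]
  induction k generalizing x with
  | zero => rfl
  | succ k ih => rw [zpow_add_one, zpow_add_one, MulAut.mul_apply, MulAut.mul_apply, ih, h]
  | pred k ih => rw [zpow_sub_one, zpow_sub_one, MulAut.mul_apply, MulAut.mul_apply, ih, h']

section Crystal

variable (Γ : Subgroup PlaneIsom)

/-- The integral combination of lattice basis vectors. -/
def latticeVec (b : Module.Basis (Fin 2) ℤ (translationLattice Γ)) (n : Fin 2 → ℤ) : Plane :=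
  ∑ i, n i • (b i : Plane)

theorem latticeVec_eq (b : Module.Basis (Fin 2) ℤ (translationLattice Γ)) (n : Fin 2 → ℤ) :
    latticeVec Γ b n = (b.equivFun.symm n : translationLattice Γ) := by
  rw [Module.Basis.equivFun_symm_apply, latticeVec, Fin.sum_univ_two, Fin.sum_univ_two]
  rfl

theorem latticeVec_mem (b : Module.Basis (Fin 2) ℤ (translationLattice Γ)) (n : Fin 2 → ℤ) :
    latticeVec Γ b n ∈ translationLattice Γ := by
  rw [latticeVec_eq]
  exact Subtype.property _

theorem latticeVec_add (b : Module.Basis (Fin 2) ℤ (translationLattice Γ)) (m n : Fin 2 → ℤ) :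
    latticeVec Γ b (m + n) = latticeVec Γ b m + latticeVec Γ b n := by
  rw [latticeVec_eq, latticeVec_eq, latticeVec_eq, map_add]
  rfl

theorem latticeVec_injective (b : Module.Basis (Fin 2) ℤ (translationLattice Γ)) :
    Function.Injective (latticeVec Γ b) := fun m n h => by
  rw [latticeVec_eq, latticeVec_eq] at h
  exact b.equivFun.symm.injective (Subtype.ext h)

theorem exists_latticeVec_eq (b : Module.Basis (Fin 2) ℤ (translationLattice Γ)) {v : Plane}
    (hv : v ∈ translationLattice Γ) : ∃ n, latticeVec Γ b n = v :=
  ⟨b.equivFun ⟨v, hv⟩, by rw [latticeVec_eq, LinearEquiv.symm_apply_apply]⟩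

variable [DiscreteTopology Γ] [CompactSpace (PlaneIsom ⧸ Γ)]

/-- The integral representation of the preimage of `Γ` on the lattice. -/
def latticeRep (b : Module.Basis (Fin 2) ℤ (translationLattice Γ)) :
    liftedGroup Γ →* Matrix (Fin 2) (Fin 2) ℤ where
  toFun g := latticeMatrix Γ b ((mem_liftedGroup Γ).1 g.2)
  map_one' := by
    apply Matrix.map_injective (Int.castRingHom ℝ).injective_int
    simp only
    rw [← toMatrix_realBasis]
    have : matLin (PlaneIsom.mk' (1 : CoverGroup).vec (rot (1 : CoverGroup).ang)).right.1 =
        LinearMap.id := LinearMap.ext fun v => by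
      change matAct (rot 0).1 v = v
      rw [rot_zero]
      exact matAct_one v
    simp only [OneMemClass.coe_one]
    rw [this, LinearMap.toMatrix_id]
    simp
  map_mul' g h := by
    apply Matrix.map_injective (Int.castRingHom ℝ).injective_int
    simp only
    rw [Matrix.map_mul, ← toMatrix_realBasis, ← toMatrix_realBasis, ← toMatrix_realBasis,
      ← LinearMap.toMatrix_mul]
    congr 1
    refine LinearMap.ext fun v => ?_
    change matAct (rot (g.1.ang + h.1.ang)).1 v =
      matAct (rot g.1.ang).1 (matAct (rot h.1.ang).1 v)
    rw [rot_add, ← matAct_mul]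
    rfl

theorem latticeRep_spec (b : Module.Basis (Fin 2) ℤ (translationLattice Γ)) (g : liftedGroup Γ)
    (j : Fin 2) : matAct (rot g.1.ang).1 (b j) = ∑ i, latticeRep Γ b g i j • (b i : Plane) :=
  latticeMatrix_spec Γ b ((mem_liftedGroup Γ).1 g.2) j

theorem latticeRep_eq_one (b : Module.Basis (Fin 2) ℤ (translationLattice Γ)) (g : liftedGroup Γ)
    (h : rot g.1.ang = 1) : latticeRep Γ b g = 1 := by
  apply Matrix.map_injective (Int.castRingHom ℝ).injective_int
  change (latticeMatrix Γ b ((mem_liftedGroup Γ).1 g.2)).map (Int.castRingHom ℝ) = _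
  rw [← toMatrix_realBasis]
  have : matLin (PlaneIsom.mk' g.1.vec (rot g.1.ang)).right.1 = LinearMap.id :=
    LinearMap.ext fun v => by
      change matAct (rot g.1.ang).1 v = v
      rw [h]
      exact matAct_one v
  rw [this, LinearMap.toMatrix_id]
  simp

theorem latticeVec_mulVec (b : Module.Basis (Fin 2) ℤ (translationLattice Γ)) (g : liftedGroup Γ)
    (n : Fin 2 → ℤ) :
    latticeVec Γ b (latticeRep Γ b g *ᵥ n) = matAct (rot g.1.ang).1 (latticeVec Γ b n) := by
  have hz : ∀ (k : ℤ) (v : Plane), matAct (rot g.1.ang).1 (k • v) =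
      k • matAct (rot g.1.ang).1 v := fun k v => map_zsmul (matLin (rot g.1.ang).1) k v
  simp only [latticeVec, Fin.sum_univ_two, matAct_add, hz, latticeRep_spec, Matrix.mulVec,
    dotProduct]
  module

theorem exists_latticeSemidirect_equiv (N : ℕ) (hN : N = Nat.card (rotationGroup Γ))
    (b : Module.Basis (Fin 2) ℤ (translationLattice Γ)) :
    ∃ M : GL (Fin 2) ℤ,
      (∀ j, matAct (rot (2 * Real.pi / N)).1 (b j) =
        ∑ i, (M : Matrix (Fin 2) (Fin 2) ℤ) i j • (b i : Plane)) ∧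
      M ^ N = 1 ∧
      ∃ e : LatticeSemidirect M ≃* liftedGroup Γ,
        (∀ n : Fin 2 → ℤ, (e (SemidirectProduct.inl (Multiplicative.ofAdd n))).1 =
          CoverGroup.mk' (∑ i, n i • (b i : Plane)) 0) ∧
        (∀ g, (e g).1.right.toAdd = 2 * Real.pi / N * (g.right.toAdd : ℝ)) := by
  obtain ⟨h0, hS, -⟩ := rotationGroup_structure Γ N hN
  obtain ⟨o, ho, -⟩ := exists_origin Γ N hN
  have hN0 : (N : ℝ) ≠ 0 := by positivity
  set θ : ℝ := 2 * Real.pi / N with hθ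
  have hθ0 : θ ≠ 0 := by positivity
  let r : liftedGroup Γ := ⟨rotAbout o θ, ho⟩
  have hrk : ∀ k : ℤ, (r ^ k).1 = rotAbout o (k * θ) := fun k => by
    rw [← rotAbout_zpow]
    rfl
  let M : GL (Fin 2) ℤ := (latticeRep Γ b).toHomUnits r
  have hM : (M : Matrix (Fin 2) (Fin 2) ℤ) = latticeRep Γ b r := rfl
  have hMN : M ^ N = 1 := by
    refine Units.ext ?_
    change ((latticeRep Γ b).toHomUnits r ^ N).1 = 1
    rw [← map_pow, MonoidHom.coe_toHomUnits]
    apply latticeRep_eq_one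
    have := hrk N
    rw [zpow_natCast] at this
    rw [this, rot_eq_one_iff]
    refine ⟨1, ?_⟩
    simp only [rotAbout, CoverGroup.ang_mk', hθ]
    push_cast
    field_simp
  let f₁ : Multiplicative (Fin 2 → ℤ) →* liftedGroup Γ :=
    { toFun := fun n => ⟨CoverGroup.mk' (latticeVec Γ b n.toAdd) 0,
        (mk'_zero_mem_liftedGroup Γ).2 (latticeVec_mem Γ b _)⟩
      map_one' := Subtype.ext (CoverGroup.ext' (by simp [latticeVec]) rfl)
      map_mul' := fun m n => Subtype.ext (CoverGroup.ext' (by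
        simp only [toAdd_mul, latticeVec_add, Subgroup.coe_mul, CoverGroup.vec_mul,
          CoverGroup.vec_mk', CoverGroup.ang_mk', rot_zero]
        congr 1
        exact (matAct_one _).symm) (by simp)) }
  let f₂ : Multiplicative ℤ →* liftedGroup Γ := zpowersHom _ r
  have hconj : ∀ n, f₁ (intAction M n) = MulAut.conj r (f₁ n) := fun n => by
    rw [MulAut.conj_apply, eq_mul_inv_iff_mul_eq]
    refine Subtype.ext (CoverGroup.ext' ?_ ?_)
    · change latticeVec Γ b (latticeRep Γ b r *ᵥ n.toAdd) + matAct (rot 0).1 r.1.vec =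
        r.1.vec + matAct (rot r.1.ang).1 (latticeVec Γ b n.toAdd)
      rw [latticeVec_mulVec, rot_zero, add_comm]
      congr 1
      exact matAct_one _
    · change 0 + r.1.ang = r.1.ang + 0
      rw [zero_add, add_zero]
  let F : LatticeSemidirect M →* liftedGroup Γ := SemidirectProduct.lift f₁ f₂ (fun g => by
    refine MonoidHom.ext fun n => ?_
    have h := MulAut.map_zpow_apply_of_semiconj f₁ (intAction M) (MulAut.conj r) hconj g.toAdd n
    rw [← map_zpow MulAut.conj] at h
    exact h)
  have hF : ∀ g : LatticeSemidirect M, F g = f₁ g.left * r ^ g.right.toAdd := fun g => rfl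
  have hang : ∀ g : LatticeSemidirect M, (F g).1.ang = θ * (g.right.toAdd : ℝ) := fun g => by
    rw [hF, Subgroup.coe_mul, CoverGroup.ang_mul, hrk]
    simp [f₁, rotAbout, mul_comm]
  have hinj : Function.Injective F := by
    rw [injective_iff_map_eq_one]
    intro g hg
    have h₁ := hang g
    rw [hg] at h₁
    have h₂ : g.right.toAdd = 0 := by
      have h₃ : θ * (g.right.toAdd : ℝ) = 0 := h₁.symm
      exact_mod_cast (mul_eq_zero.1 h₃).resolve_left hθ0
    have h₄ := hF g
    rw [hg, h₂, zpow_zero, mul_one] at h₄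
    refine SemidirectProduct.ext ?_ h₂
    apply Multiplicative.toAdd.injective
    apply latticeVec_injective Γ b
    have h₅ := congrArg (fun x : liftedGroup Γ => x.1.vec) h₄
    have h₆ : latticeVec Γ b 0 = 0 := by simp [latticeVec]
    exact h₅.symm.trans h₆.symm
  have hsurj : Function.Surjective F := by
    intro g
    have h₁ := ang_mem_angleGroup Γ g.2
    rw [hS] at h₁
    obtain ⟨k, hk⟩ := h₁
    simp only [zsmul_eq_mul] at hk
    have hrk' : (r ^ k).1.ang = g.1.ang := by
      rw [hrk, ← hk]
      rfl
    obtain ⟨n, hn⟩ := exists_latticeVec_eq Γ b (sub_mem_of_ang_eq Γ g.2 (r ^ k).2 hrk'.symm)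
    refine ⟨⟨Multiplicative.ofAdd n, Multiplicative.ofAdd k⟩, ?_⟩
    rw [hF]
    refine Subtype.ext (CoverGroup.ext' ?_ ?_)
    · change latticeVec Γ b n + matAct (rot 0).1 (r ^ k).1.vec = g.1.vec
      rw [hn, rot_zero]
      change _ + matAct 1 _ = _
      rw [matAct_one, sub_add_cancel]
    · change 0 + (r ^ k).1.ang = g.1.ang
      rw [hrk', zero_add]
  refine ⟨M, fun j => ?_, hMN, MulEquiv.ofBijective F ⟨hinj, hsurj⟩, fun n => ?_, hang⟩
  · rw [hM]
    exact latticeRep_spec Γ b r j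
  · change (F (SemidirectProduct.inl (Multiplicative.ofAdd n))).1 = _
    rw [hF, SemidirectProduct.left_inl, SemidirectProduct.right_inl, toAdd_one, zpow_zero, mul_one]
    rfl

end Crystal


/-! ### Cutting the punctured plane along rays -/

/-- Rotated coordinates of the plane in which finitely many points have first coordinates at
distance at least `2 ε` from each other. -/
structure PlaneCut {m : ℕ} (p : Fin m → Plane) where
  /-- The angle of rotation. -/
  α : ℝ
  /-- Half the distance between the cuts. -/
  ε : ℝ
  α_pos : 0 < α
  α_lt : α < Real.pi / 2
  ε_pos : 0 < ε
  sep : ∀ i j, i ≠ j → 2 * ε ≤ |(Real.cos α * p i 0 + Real.sin α * p i 1) -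
    (Real.cos α * p j 0 + Real.sin α * p j 1)|

theorem exists_angle_ne_zero {ι : Type*} [Finite ι] (v : ι → ℝ × ℝ) (hv : ∀ i, v i ≠ 0) :
    ∃ α, 0 < α ∧ α < Real.pi / 2 ∧ ∀ i, Real.cos α * (v i).1 + Real.sin α * (v i).2 ≠ 0 := by
  let B : ι → Set ℝ := fun i =>
    {α | α ∈ Set.Ioo 0 (Real.pi / 2) ∧ Real.cos α * (v i).1 + Real.sin α * (v i).2 = 0}
  have hB : ∀ i, (B i).Subsingleton := by
    rintro i a ⟨ha, ha'⟩ b ⟨hb, hb'⟩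
    have h₁ : Real.sin (a - b) * (v i).1 = 0 := by
      rw [Real.sin_sub]
      linear_combination Real.sin a * hb' - Real.sin b * ha'
    have h₂ : Real.sin (a - b) * (v i).2 = 0 := by
      rw [Real.sin_sub]
      linear_combination Real.cos b * ha' - Real.cos a * hb'
    have h₃ : Real.sin (a - b) = 0 := by
      by_contra h
      exact hv i (Prod.ext ((mul_eq_zero.1 h₁).resolve_left h) ((mul_eq_zero.1 h₂).resolve_left h))
    have h₄ := (Real.sin_eq_zero_iff_of_lt_of_lt (by linarith [ha.1, hb.2, Real.pi_pos])
      (by linarith [ha.2, hb.1, Real.pi_pos])).1 h₃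
    linarith
  have hfin : (⋃ i, B i).Finite := Set.finite_iUnion fun i => (hB i).finite
  have hinf : (Set.Ioo 0 (Real.pi / 2)).Infinite := Set.Ioo_infinite (by positivity)
  obtain ⟨α, hα, hα'⟩ := (hinf.sdiff hfin).nonempty
  exact ⟨α, hα.1, hα.2, fun i h => hα' (Set.mem_iUnion.2 ⟨i, hα, h⟩)⟩

theorem nonempty_planeCut {m : ℕ} (p : Fin m → Plane) (hp : Function.Injective p) :
    Nonempty (PlaneCut p) := by
  obtain ⟨α, h0, h1, h⟩ := exists_angle_ne_zero
    (fun q : {q : Fin m × Fin m // q.1 ≠ q.2} => (p q.1.1 0 - p q.1.2 0, p q.1.1 1 - p q.1.2 1))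
    (fun q h => q.2 (hp (by
      have h₀ := congrArg Prod.fst h
      have h₁ := congrArg Prod.snd h
      ext i
      fin_cases i
      · exact sub_eq_zero.1 h₀
      · exact sub_eq_zero.1 h₁)))
  let d : Fin m × Fin m → ℝ := fun q => |(Real.cos α * p q.1 0 + Real.sin α * p q.1 1) -
    (Real.cos α * p q.2 0 + Real.sin α * p q.2 1)|
  have hd : ∀ q : Fin m × Fin m, q.1 ≠ q.2 → 0 < d q := fun q hq => by
    refine abs_pos.2 fun h' => h ⟨q, hq⟩ ?_
    simp only
    linarith
  obtain ⟨r, hr, hr'⟩ : ∃ r : ℝ, 0 < r ∧ ∀ q : Fin m × Fin m, q.1 ≠ q.2 → r ≤ d q := by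
    rcases (Finset.univ.filter fun q : Fin m × Fin m => q.1 ≠ q.2).eq_empty_or_nonempty with
      he | hne
    · exact ⟨1, one_pos, fun q hq => by
        have : q ∈ Finset.univ.filter fun q : Fin m × Fin m => q.1 ≠ q.2 := by simpa using hq
        simp [he] at this⟩
    · obtain ⟨q, hq, hq'⟩ := Finset.exists_min_image _ d hne
      exact ⟨d q, hd q (by simpa using hq), fun q' h' => hq' q' (by simpa using h')⟩
  exact ⟨⟨α, r / 2, h0, h1, by positivity, fun i j hij => by
    have := hr' (i, j) hij
    simp only [d] at this
    linarith⟩⟩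

namespace PlaneCut

variable {m : ℕ} {p : Fin m → Plane} (c : PlaneCut p)

/-- The first rotated coordinate. -/
def x (z : Plane) : ℝ := Real.cos c.α * z 0 + Real.sin c.α * z 1

/-- The second rotated coordinate. -/
def y (z : Plane) : ℝ := -Real.sin c.α * z 0 + Real.cos c.α * z 1

theorem continuous_x : Continuous c.x := by
  unfold x
  fun_prop

theorem continuous_y : Continuous c.y := by
  unfold y
  fun_prop

theorem x_add (z w : Plane) : c.x (z + w) = c.x z + c.x w := by
  simp only [x, PiLp.add_apply]
  ring

theorem y_add (z w : Plane) : c.y (z + w) = c.y z + c.y w := by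
  simp only [y, PiLp.add_apply]
  ring

theorem x_smul (r : ℝ) (z : Plane) : c.x (r • z) = r * c.x z := by
  simp only [x, PiLp.smul_apply, smul_eq_mul]
  ring

theorem y_smul (r : ℝ) (z : Plane) : c.y (r • z) = r * c.y z := by
  simp only [y, PiLp.smul_apply, smul_eq_mul]
  ring

/-- The direction of the cuts. -/
def dir : Plane := !₂[-Real.sin c.α, Real.cos c.α]

/-- The direction orthogonal to the cuts. -/
def dir' : Plane := !₂[Real.cos c.α, Real.sin c.α]

theorem x_dir : c.x c.dir = 0 := by
  simp [x, dir]
  ring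

theorem y_dir : c.y c.dir = 1 := by
  simp [y, dir]
  nlinarith [Real.sin_sq_add_cos_sq c.α]

theorem x_dir' : c.x c.dir' = 1 := by
  simp [x, dir']
  nlinarith [Real.sin_sq_add_cos_sq c.α]

theorem y_dir' : c.y c.dir' = 0 := by
  simp [y, dir']
  ring

theorem ext_xy {z w : Plane} (hx : c.x z = c.x w) (hy : c.y z = c.y w) : z = w := by
  have hcs := Real.sin_sq_add_cos_sq c.α
  simp only [x, y] at hx hy
  ext i
  fin_cases i
  · change z 0 = w 0
    linear_combination Real.cos c.α * hx - Real.sin c.α * hy - (z 0 - w 0) * hcs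
  · change z 1 = w 1
    linear_combination Real.sin c.α * hx + Real.cos c.α * hy - (z 1 - w 1) * hcs

theorem sep_x {i j : Fin m} (h : i ≠ j) : 2 * c.ε ≤ |c.x (p i) - c.x (p j)| := c.sep i j h

/-- The plane cut along the rays starting at the points `p i`. -/
def D : Set Plane := {z | ∀ i, c.x z ≠ c.x (p i) ∨ c.y z < c.y (p i)}

/-- A half strip around the ray starting at `p i`. -/
def E (i : Fin m) : Set Plane := {z | c.y (p i) < c.y z ∧ |c.x z - c.x (p i)| < c.ε}

theorem isOpen_D : IsOpen c.D := by
  have : c.D = ⋂ i, ({z | c.x z ≠ c.x (p i)} ∪ {z | c.y z < c.y (p i)}) := by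
    ext z
    simp [D]
  rw [this]
  exact isOpen_iInter_of_finite fun i => (isOpen_ne_fun c.continuous_x continuous_const).union
    (isOpen_lt c.continuous_y continuous_const)

theorem isOpen_E (i : Fin m) : IsOpen (c.E i) :=
  (isOpen_lt continuous_const c.continuous_y).inter
    (isOpen_lt (c.continuous_x.sub continuous_const).abs continuous_const)

theorem D_subset : c.D ⊆ (Set.range p)ᶜ := by
  rintro z hz ⟨i, rfl⟩
  rcases hz i with h | h
  · exact h rfl
  · exact lt_irrefl _ h

theorem x_ne_of_E {i j : Fin m} {z : Plane} (hz : z ∈ c.E i) (hij : j ≠ i) :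
    c.ε < |c.x z - c.x (p j)| := by
  have h₁ := c.sep_x hij
  have h₂ := hz.2
  have h₃ := abs_sub_le (c.x (p j)) (c.x z) (c.x (p i))
  rw [abs_sub_comm (c.x (p j)) (c.x z)] at h₃
  linarith

theorem E_unique {i j : Fin m} {z : Plane} (hi : z ∈ c.E i) (hj : z ∈ c.E j) : j = i := by
  by_contra h
  exact absurd hj.2 (not_lt.2 (c.x_ne_of_E hi h).le)

theorem E_subset (i : Fin m) : c.E i ⊆ (Set.range p)ᶜ := by
  rintro z hz ⟨j, rfl⟩
  by_cases h : j = i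
  · subst h
    exact lt_irrefl _ hz.1
  · have := c.x_ne_of_E hz h
    rw [sub_self, abs_zero] at this
    linarith [c.ε_pos]

theorem mem_D_iff_of_E {i : Fin m} {z : Plane} (hz : z ∈ c.E i) :
    z ∈ c.D ↔ c.x z ≠ c.x (p i) := by
  constructor
  · intro h
    exact (h i).resolve_right (not_lt.2 hz.1.le)
  · intro h j
    by_cases hj : j = i
    · subst hj
      exact Or.inl h
    · left
      intro h'
      have := c.x_ne_of_E hz hj
      rw [h', sub_self, abs_zero] at this
      linarith [c.ε_pos]

theorem mem_D_or_E {z : Plane} (hz : z ∈ (Set.range p)ᶜ) : z ∈ c.D ∨ ∃ i, z ∈ c.E i := by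
  by_contra h
  push Not at h
  obtain ⟨h₁, h₂⟩ := h
  simp only [D, Set.mem_ofPred_eq, not_forall, not_or, not_not, not_lt] at h₁
  obtain ⟨i, hx, hy⟩ := h₁
  rcases hy.lt_or_eq with hy | hy
  · refine h₂ i ⟨hy, ?_⟩
    rw [hx, sub_self, abs_zero]
    exact c.ε_pos
  · exact hz ⟨i, (c.ext_xy hx hy.symm).symm⟩

theorem convex_preimage {s : Set (ℝ × ℝ)} (hs : Convex ℝ s) :
    Convex ℝ {z | (c.x z, c.y z) ∈ s} := by
  intro z hz w hw a b ha hb hab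
  have := hs hz hw ha hb hab
  simp only [Set.mem_ofPred_eq, x_add, y_add, x_smul, y_smul]
  simpa using this

theorem exists_xy (a b : ℝ) : ∃ z, c.x z = a ∧ c.y z = b :=
  ⟨a • c.dir' + b • c.dir, by rw [x_add, x_smul, x_smul, x_dir, x_dir']; ring,
    by rw [y_add, y_smul, y_smul, y_dir, y_dir']; ring⟩

theorem convex_E (i : Fin m) : Convex ℝ (c.E i) := by
  have h : c.E i = {z | (c.x z, c.y z) ∈
      Set.Ioo (c.x (p i) - c.ε) (c.x (p i) + c.ε) ×ˢ Set.Ioi (c.y (p i))} := by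
    ext z
    simp only [E, Set.mem_ofPred_eq, Set.mem_prod, Set.mem_Ioo, Set.mem_Ioi, abs_lt]
    constructor
    · rintro ⟨h₁, h₂, h₃⟩
      exact ⟨⟨by linarith, by linarith⟩, h₁⟩
    · rintro ⟨⟨h₂, h₃⟩, h₁⟩
      exact ⟨h₁, by linarith, by linarith⟩
  rw [h]
  exact c.convex_preimage ((convex_Ioo _ _).prod (convex_Ioi _))

/-- The part of the half strip to the left of the cut. -/
def EL (i : Fin m) : Set Plane := {z | z ∈ c.E i ∧ c.x z < c.x (p i)}

/-- The part of the half strip to the right of the cut. -/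
def ER (i : Fin m) : Set Plane := {z | z ∈ c.E i ∧ c.x (p i) < c.x z}

theorem convex_EL (i : Fin m) : Convex ℝ (c.EL i) := by
  have := (c.convex_E i).inter (c.convex_preimage ((convex_Iio (c.x (p i))).prod convex_univ))
  convert this using 1
  ext z
  simp [EL]

theorem convex_ER (i : Fin m) : Convex ℝ (c.ER i) := by
  have := (c.convex_E i).inter (c.convex_preimage ((convex_Ioi (c.x (p i))).prod convex_univ))
  convert this using 1
  ext z
  simp [ER]

theorem EL_subset (i : Fin m) : c.EL i ⊆ c.D := fun _ hz => (c.mem_D_iff_of_E hz.1).2 hz.2.ne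

theorem ER_subset (i : Fin m) : c.ER i ⊆ c.D := fun _ hz => (c.mem_D_iff_of_E hz.1).2 hz.2.ne'

theorem nonempty_EL (i : Fin m) : (c.EL i).Nonempty := by
  obtain ⟨z, hx, hy⟩ := c.exists_xy (c.x (p i) - c.ε / 2) (c.y (p i) + 1)
  have := c.ε_pos
  refine ⟨z, ⟨by rw [hy]; linarith, ?_⟩, by rw [hx]; linarith⟩
  rw [hx, abs_lt]
  constructor <;> linarith

theorem nonempty_ER (i : Fin m) : (c.ER i).Nonempty := by
  obtain ⟨z, hx, hy⟩ := c.exists_xy (c.x (p i) + c.ε / 2) (c.y (p i) + 1)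
  have := c.ε_pos
  refine ⟨z, ⟨by rw [hy]; linarith, ?_⟩, by rw [hx]; linarith⟩
  rw [hx, abs_lt]
  constructor <;> linarith

theorem contractibleSpace_E (i : Fin m) : ContractibleSpace (c.E i) :=
  (c.convex_E i).contractibleSpace ((c.nonempty_EL i).mono fun _ hz => hz.1)

theorem mem_D_of_y_le {z w : Plane} (hz : z ∈ c.D) (hx : c.x w = c.x z) (hy : c.y w ≤ c.y z) :
    w ∈ c.D := fun i => by
  rcases hz i with h | h
  · exact Or.inl (by rwa [hx])
  · exact Or.inr (lt_of_le_of_lt hy h)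

theorem exists_half_plane : ∃ b : ℝ, ∀ z, c.y z ≤ b → z ∈ c.D := by
  obtain ⟨b, hb⟩ := (Set.finite_range fun i => c.y (p i)).bddBelow
  refine ⟨b - 1, fun z hz i => Or.inr ?_⟩
  have := hb ⟨i, rfl⟩
  simp only at this
  linarith

instance contractibleSpace_D : ContractibleSpace c.D := by
  obtain ⟨b, hb⟩ := c.exists_half_plane
  obtain ⟨o, -, ho⟩ := c.exists_xy 0 b
  have hy : ∀ (t : I) (z : Plane), c.y (z - ((t : ℝ) * max 0 (c.y z - b)) • c.dir) =
      c.y z - t * max 0 (c.y z - b) := fun t z => by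
    rw [sub_eq_add_neg, ← neg_smul, y_add, y_smul, y_dir]
    ring
  have hx : ∀ (t : I) (z : Plane), c.x (z - ((t : ℝ) * max 0 (c.y z - b)) • c.dir) = c.x z :=
    fun t z => by
    rw [sub_eq_add_neg, ← neg_smul, x_add, x_smul, x_dir]
    ring
  have hcont : Continuous fun q : I × c.D =>
      (q.2 : Plane) - ((q.1 : ℝ) * max 0 (c.y q.2 - b)) • c.dir := by
    have := c.continuous_y
    fun_prop
  let K₁ : C(I × c.D, c.D) := ⟨fun q => ⟨q.2 - ((q.1 : ℝ) * max 0 (c.y q.2 - b)) • c.dir,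
    c.mem_D_of_y_le q.2.2 (hx _ _) (by
      rw [hy]
      have : 0 ≤ (q.1 : ℝ) * max 0 (c.y q.2 - b) := mul_nonneg q.1.2.1 (le_max_left _ _)
      linarith)⟩, hcont.subtype_mk _⟩
  let ρ : C(c.D, c.D) := K₁.comp ((ContinuousMap.const _ 1).prodMk (ContinuousMap.id _))
  have hρ : ∀ z, c.y (ρ z) ≤ b := fun z => by
    change c.y (z.1 - (((1 : I) : ℝ) * max 0 (c.y z - b)) • c.dir) ≤ b
    rw [hy]
    have := le_max_right 0 (c.y z - b)
    simp only [Set.Icc.coe_one, one_mul]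
    linarith
  have h₁ : (ContinuousMap.id c.D).Homotopic ρ :=
    ⟨{ toContinuousMap := K₁
       map_zero_left := fun z => Subtype.ext (by simp [K₁])
       map_one_left := fun z => rfl }⟩
  have h₂ : ρ.Homotopic (ContinuousMap.const _ ⟨o, hb o ho.le⟩) :=
    ⟨{ toFun := fun q => ⟨(1 - (q.1 : ℝ)) • (ρ q.2 : Plane) + (q.1 : ℝ) • o, hb _ (by
        rw [y_add, y_smul, y_smul, ho]
        have := hρ q.2
        nlinarith [q.1.2.1, q.1.2.2])⟩
       continuous_toFun := by
        refine Continuous.subtype_mk ?_ _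
        fun_prop
       map_zero_left := fun z => Subtype.ext (by simp)
       map_one_left := fun z => Subtype.ext (by simp) }⟩
  exact (contractible_iff_id_nullhomotopic _).2 ⟨_, h₁.trans h₂⟩

theorem isPreconnected_D : IsPreconnected c.D :=
  isPreconnected_iff_preconnectedSpace.2 inferInstance

theorem nonempty_D : c.D.Nonempty := Set.nonempty_coe_sort.1 inferInstance

/-- Continuous families of maps on the pieces glue to a family of maps on the punctured plane. -/
theorem exists_glue {T Y : Type} [TopologicalSpace T] [TopologicalSpace Y]
    (gD : T × Plane → Y) (gE : Fin m → T × Plane → Y)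
    (hD : ContinuousOn gD (Set.univ ×ˢ c.D)) (hE : ∀ i, ContinuousOn (gE i) (Set.univ ×ˢ c.E i))
    (h : ∀ t i z, z ∈ c.D → z ∈ c.E i → gD (t, z) = gE i (t, z)) :
    ∃ g : C(T × ↥((Set.range p)ᶜ), Y), ∀ t (z : ↥((Set.range p)ᶜ)),
      (z.1 ∈ c.D → g (t, z) = gD (t, z)) ∧ ∀ i, z.1 ∈ c.E i → g (t, z) = gE i (t, z) := by
  classical
  let g : T × ↥((Set.range p)ᶜ) → Y := fun q =>
    if hz : ∃ i, q.2.1 ∈ c.E i then gE hz.choose (q.1, q.2) else gD (q.1, q.2)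
  have hgE : ∀ t (z : ↥((Set.range p)ᶜ)) i, z.1 ∈ c.E i → g (t, z) = gE i (t, z) := by
    intro t z i hz
    have hex : ∃ i, z.1 ∈ c.E i := ⟨i, hz⟩
    have : hex.choose = i := c.E_unique hz hex.choose_spec
    simp only [g, dif_pos hex, this]
  have hgD : ∀ t (z : ↥((Set.range p)ᶜ)), z.1 ∈ c.D → g (t, z) = gD (t, z) := by
    intro t z hz
    by_cases hex : ∃ i, z.1 ∈ c.E i
    · obtain ⟨i, hi⟩ := hex
      rw [hgE t z i hi, h t i z hz hi]
    · simp only [g, dif_neg hex]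
  have hι : Continuous fun q : T × ↥((Set.range p)ᶜ) => (q.1, (q.2 : Plane)) :=
    continuous_fst.prodMk (continuous_subtype_val.comp continuous_snd)
  have hg : Continuous g := by
    rw [continuous_iff_continuousAt]
    rintro ⟨t, z⟩
    rcases c.mem_D_or_E z.2 with hz | ⟨i, hz⟩
    · have hopen := (isOpen_univ.prod c.isOpen_D).preimage hι
      refine ContinuousOn.continuousAt (s := _) ?_
        (hopen.mem_nhds (show (t, z) ∈ _ from ⟨trivial, hz⟩))
      refine (hD.comp hι.continuousOn fun q hq => hq).congr fun q hq => ?_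
      exact hgD q.1 q.2 hq.2
    · have hopen := (isOpen_univ.prod (c.isOpen_E i)).preimage hι
      refine ContinuousOn.continuousAt (s := _) ?_
        (hopen.mem_nhds (show (t, z) ∈ _ from ⟨trivial, hz⟩))
      refine ((hE i).comp hι.continuousOn fun q hq => hq).congr fun q hq => ?_
      exact hgE q.1 q.2 i hq.2
  exact ⟨⟨g, hg⟩, fun t z => ⟨hgD t z, hgE t z⟩⟩

end PlaneCut


/-! ### Lifts and jumps -/

theorem IsCoveringMap.exists_lift_of_contractible {A E X : Type} [TopologicalSpace A]
    [TopologicalSpace E] [TopologicalSpace X] [ContractibleSpace A] {q : E → X}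
    (cov : IsCoveringMap q) (hq : Function.Surjective q) (l : C(A, X)) :
    ∃ L : C(A, E), ∀ a, q (L a) = l a := by
  obtain ⟨a₀, ⟨H⟩⟩ := id_nullhomotopic A
  obtain ⟨e, he⟩ := hq (l a₀)
  let K : C(I × A, X) := l.comp H.symm.toContinuousMap
  have K0 : ∀ a, K (0, a) = q ((ContinuousMap.const A e) a) := fun a => by
    have : H.symm.toContinuousMap (0, a) = a₀ := H.symm.apply_zero a
    change l (H.symm.toContinuousMap (0, a)) = q e
    rw [this, he]
  refine ⟨(cov.liftHomotopy K (ContinuousMap.const A e) K0).comp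
    ((ContinuousMap.const _ 1).prodMk (ContinuousMap.id _)), fun a => ?_⟩
  refine (congrFun (cov.liftHomotopy_lifts K (ContinuousMap.const A e) K0) (1, a)).trans ?_
  exact congrArg l (H.symm.apply_one a)

section Crystal

variable {Γ : Subgroup PlaneIsom} {U : Set Plane}

/-- `F` is a continuous lift of `f` on `S`. -/
structure IsLiftOn (f : C(U, OrderSpace Γ)) (S : Set Plane) (F : Plane → CoverGroup) : Prop where
  continuousOn : ContinuousOn F S
  proj : ∀ z (hz : z ∈ U), z ∈ S → coverProj Γ (F z) = f ⟨z, hz⟩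

variable {f f' : C(U, OrderSpace Γ)} {S : Set Plane} {F G : Plane → CoverGroup}

theorem IsLiftOn.mul_right (h : IsLiftOn f S F) (γ : liftedGroup Γ) :
    IsLiftOn f S fun z => F z * γ where
  continuousOn := (continuous_mul_const γ.1).comp_continuousOn h.continuousOn
  proj z hz hzS := (coverProj_mul Γ _ γ).trans (h.proj z hz hzS)

theorem IsLiftOn.mono (h : IsLiftOn f S F) {T : Set Plane} (hT : T ⊆ S) : IsLiftOn f T F :=
  ⟨h.continuousOn.mono hT, fun z hz hzT => h.proj z hz (hT hzT)⟩

variable [DiscreteTopology Γ]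

theorem IsLiftOn.exists_mul (hF : IsLiftOn f S F) (hG : IsLiftOn f S G) (hSU : S ⊆ U)
    (hS : IsPreconnected S) (hne : S.Nonempty) :
    ∃ γ : liftedGroup Γ, ∀ z ∈ S, F z = G z * γ := by
  obtain ⟨z₀, h₀⟩ := hne
  have hm : (G z₀)⁻¹ * F z₀ ∈ liftedGroup Γ := by
    rw [← coverProj_eq_iff, hF.proj z₀ (hSU h₀) h₀, hG.proj z₀ (hSU h₀) h₀]
  have hG' := hG.mul_right ⟨_, hm⟩
  refine ⟨⟨_, hm⟩, fun z hz => ?_⟩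
  refine (isCoveringMap_coverProj Γ).eqOn_of_comp_eqOn hS hF.continuousOn hG'.continuousOn
    (fun w hw => ?_) h₀ (by simp) hz
  exact (hF.proj w (hSU hw) hw).trans (hG'.proj w (hSU hw) hw).symm

theorem exists_isLiftOn (f : C(U, OrderSpace Γ)) (hSU : S ⊆ U) (hS : ContractibleSpace S) :
    ∃ F, IsLiftOn f S F := by
  classical
  obtain ⟨L, hL⟩ := (isCoveringMap_coverProj Γ).exists_lift_of_contractible
    (coverProj_surjective Γ) (f.comp ⟨Set.inclusion hSU, continuous_inclusion hSU⟩)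
  refine ⟨fun z => if hz : z ∈ S then L ⟨z, hz⟩ else 1, ?_, fun z hz hzS => ?_⟩
  · rw [continuousOn_iff_continuous_domRestrict]
    refine L.continuous.congr fun z => ?_
    simp
  · simp only [dif_pos hzS]
    exact hL _

/-- Lifts can be transported along homotopies. -/
theorem IsLiftOn.transport (hF : IsLiftOn f S F) (hSU : S ⊆ U) (K : f.Homotopy f') :
    ∃ F' : I → Plane → CoverGroup, IsLiftOn f' S (F' 1) ∧ (∀ z ∈ S, F' 0 z = F z) ∧
      (∀ z ∈ S, Continuous fun t => F' t z) ∧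
      ∀ t z (hz : z ∈ U), z ∈ S → coverProj Γ (F' t z) = K (t, ⟨z, hz⟩) := by
  classical
  have cov := isCoveringMap_coverProj Γ
  let L : C(S, CoverGroup) := ⟨S.domRestrict F, continuousOn_iff_continuous_domRestrict.1 hF.continuousOn⟩
  let H : C(I × S, OrderSpace Γ) := K.toContinuousMap.comp
    ((ContinuousMap.id I).prodMap ⟨Set.inclusion hSU, continuous_inclusion hSU⟩)
  have H0 : ∀ z, H (0, z) = coverProj Γ (L z) := fun z =>
    (K.apply_zero _).trans (hF.proj z (hSU z.2) z.2).symm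
  let M := cov.liftHomotopy H L H0
  have hM : ∀ q, coverProj Γ (M q) = H q := congrFun (cov.liftHomotopy_lifts H L H0)
  let F' : I → Plane → CoverGroup := fun t z => if hz : z ∈ S then M (t, ⟨z, hz⟩) else 1
  have hF' : ∀ t z (hz : z ∈ S), F' t z = M (t, ⟨z, hz⟩) := fun t z hz => dif_pos hz
  refine ⟨F', ⟨?_, fun z hz hzS => ?_⟩, fun z hz => ?_, fun z hz => ?_, fun t z hz hzS => ?_⟩
  · rw [continuousOn_iff_continuous_domRestrict]
    refine (M.continuous.comp (continuous_const.prodMk continuous_id)).congr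
      fun z => (hF' 1 z z.2).symm
  · rw [hF' 1 z hzS, hM]
    exact K.apply_one _
  · rw [hF' 0 z hz]
    exact cov.liftHomotopy_zero H L H0 ⟨z, hz⟩
  · simp only [hF' _ z hz]
    exact M.continuous.comp (continuous_id.prodMk continuous_const)
  · rw [hF' t z hzS, hM]
    rfl

variable {m : ℕ} {p : Fin m → Plane} (c : PlaneCut p)

/-- The map `f` has a lift to the cut plane that jumps by `b i` at the `i`-th cut. -/
def HasJump (f : C(↥((Set.range p)ᶜ), OrderSpace Γ)) (b : Fin m → liftedGroup Γ) : Prop :=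
  ∃ (F : Plane → CoverGroup) (G : Fin m → Plane → CoverGroup),
    IsLiftOn f c.D F ∧ (∀ i, IsLiftOn f (c.E i) (G i)) ∧
      ∀ i, (∀ z ∈ c.EL i, F z = G i z) ∧ ∀ z ∈ c.ER i, F z = G i z * b i

theorem exists_hasJump (f : C(↥((Set.range p)ᶜ), OrderSpace Γ)) : ∃ b, HasJump c f b := by
  obtain ⟨F, hF⟩ := exists_isLiftOn f c.D_subset inferInstance
  choose G hG using fun i => exists_isLiftOn f (c.E_subset i) (c.contractibleSpace_E i)
  choose l hl using fun i => (hF.mono (c.EL_subset i)).exists_mul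
    ((hG i).mono fun _ hz => hz.1) ((c.EL_subset i).trans c.D_subset)
    (c.convex_EL i).isPreconnected (c.nonempty_EL i)
  choose r hr using fun i => (hF.mono (c.ER_subset i)).exists_mul
    ((hG i).mono fun _ hz => hz.1) ((c.ER_subset i).trans c.D_subset)
    (c.convex_ER i).isPreconnected (c.nonempty_ER i)
  refine ⟨fun i => (l i)⁻¹ * r i, F, fun i z => G i z * l i, hF, fun i => (hG i).mul_right _,
    fun i => ⟨hl i, fun z hz => ?_⟩⟩
  rw [hr i z hz]
  simp [mul_assoc]

variable {c} {f₁ f₂ : C(↥((Set.range p)ᶜ), OrderSpace Γ)} {b b' : Fin m → liftedGroup Γ}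

omit [DiscreteTopology Γ] in
theorem HasJump.conj (h : HasJump c f₁ b) (γ : liftedGroup Γ) :
    HasJump c f₁ fun i => γ * b i * γ⁻¹ := by
  obtain ⟨F, G, hF, hG, hb⟩ := h
  refine ⟨fun z => F z * (γ⁻¹ : liftedGroup Γ), fun i z => G i z * (γ⁻¹ : liftedGroup Γ),
    hF.mul_right _, fun i => (hG i).mul_right _, fun i => ⟨fun z hz => ?_, fun z hz => ?_⟩⟩
  · simp only [(hb i).1 z hz]
  · simp [(hb i).2 z hz, mul_assoc]

theorem HasJump.exists_conj (h : HasJump c f₁ b) (h' : HasJump c f₁ b') :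
    ∃ γ : liftedGroup Γ, ∀ i, b' i = γ * b i * γ⁻¹ := by
  obtain ⟨F, G, hF, hG, hb⟩ := h
  obtain ⟨F', G', hF', hG', hb'⟩ := h'
  obtain ⟨γ, hγ⟩ := hF'.exists_mul hF c.D_subset c.isPreconnected_D c.nonempty_D
  refine ⟨γ⁻¹, fun i => ?_⟩
  obtain ⟨δ, hδ⟩ := (hG' i).exists_mul (hG i) (c.E_subset i) (c.convex_E i).isPreconnected
    ((c.nonempty_EL i).mono fun _ hz => hz.1)
  obtain ⟨z, hz⟩ := c.nonempty_EL i
  have e₁ := (hb' i).1 z hz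
  rw [hγ z (c.EL_subset i hz), hδ z hz.1, (hb i).1 z hz, mul_right_inj] at e₁
  obtain ⟨w, hw⟩ := c.nonempty_ER i
  have e₂ := (hb' i).2 w hw
  rw [hγ w (c.ER_subset i hw), hδ w hw.1, (hb i).2 w hw, ← e₁, mul_assoc, mul_assoc,
    mul_right_inj] at e₂
  refine Subtype.ext ?_
  simp only [Subgroup.coe_mul, Subgroup.coe_inv, inv_inv]
  rw [mul_assoc, e₂, inv_mul_cancel_left]

theorem HasJump.of_homotopic (h : HasJump c f₁ b) (hf : f₁.Homotopic f₂) : HasJump c f₂ b := by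
  obtain ⟨F, G, hF, hG, hb⟩ := h
  obtain ⟨K⟩ := hf
  have cov := isCoveringMap_coverProj Γ
  obtain ⟨F', hF', hF0, hFc, hFp⟩ := hF.transport c.D_subset K
  choose G' hG' hG0 hGc hGp using fun i => (hG i).transport (c.E_subset i) K
  refine ⟨F' 1, fun i => G' i 1, hF', hG', fun i => ⟨fun z hz => ?_, fun z hz => ?_⟩⟩
  · have hzU := c.E_subset i hz.1
    have := cov.eq_of_comp_eq (hFc z (c.EL_subset i hz)) (hGc i z hz.1) (funext fun t =>
      (hFp t z hzU (c.EL_subset i hz)).trans (hGp i t z hzU hz.1).symm) 0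
      (by rw [hF0 z (c.EL_subset i hz), hG0 i z hz.1, (hb i).1 z hz])
    exact congrFun this 1
  · have hzU := c.E_subset i hz.1
    have := cov.eq_of_comp_eq (hFc z (c.ER_subset i hz))
      (g₂ := fun t => G' i t z * b i) ((hGc i z hz.1).mul continuous_const) (funext fun t =>
      (hFp t z hzU (c.ER_subset i hz)).trans
        ((coverProj_mul Γ _ _).trans (hGp i t z hzU hz.1)).symm) 0
      (by simp only [hF0 z (c.ER_subset i hz), hG0 i z hz.1, (hb i).2 z hz])
    exact congrFun this 1

omit [DiscreteTopology Γ] in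
theorem mem_EL_or_ER {i : Fin m} {z : Plane} (hD : z ∈ c.D) (hE : z ∈ c.E i) :
    z ∈ c.EL i ∨ z ∈ c.ER i := by
  rcases lt_or_gt_of_ne ((c.mem_D_iff_of_E hE).1 hD) with h | h
  · exact Or.inl ⟨hE, h⟩
  · exact Or.inr ⟨hE, h⟩

omit [DiscreteTopology Γ] in
theorem continuousOn_interp_lifts {f f' : C(U, OrderSpace Γ)} (hF : IsLiftOn f S F)
    (hG : IsLiftOn f' S G) :
    ContinuousOn (fun q : I × Plane => coverProj Γ (CoverGroup.interp (F q.2) (G q.2) q.1))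
      (Set.univ ×ˢ S) := by
  have h₁ : ContinuousOn (fun q : I × Plane => F q.2) (Set.univ ×ˢ S) :=
    hF.continuousOn.comp continuousOn_snd fun q hq => hq.2
  have h₂ : ContinuousOn (fun q : I × Plane => G q.2) (Set.univ ×ˢ S) :=
    hG.continuousOn.comp continuousOn_snd fun q hq => hq.2
  rw [continuousOn_iff_continuous_domRestrict] at h₁ h₂ ⊢
  exact (coverProj Γ).continuous.comp (CoverGroup.continuous_interp h₁ h₂
    (continuous_subtype_val.comp (continuous_fst.comp continuous_subtype_val)))

omit [DiscreteTopology Γ] in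
theorem HasJump.homotopic (h₁ : HasJump c f₁ b) (h₂ : HasJump c f₂ b) : f₁.Homotopic f₂ := by
  obtain ⟨F, G, hF, hG, hb⟩ := h₁
  obtain ⟨F', G', hF', hG', hb'⟩ := h₂
  obtain ⟨g, hg⟩ := c.exists_glue (T := I)
    (fun q => coverProj Γ (CoverGroup.interp (F q.2) (F' q.2) q.1))
    (fun i q => coverProj Γ (CoverGroup.interp (G i q.2) (G' i q.2) q.1))
    (continuousOn_interp_lifts hF hF') (fun i => continuousOn_interp_lifts (hG i) (hG' i))
    (fun t i z hD hE => by
      rcases mem_EL_or_ER hD hE with hz | hz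
      · simp only [(hb i).1 z hz, (hb' i).1 z hz]
      · simp only [(hb i).2 z hz, (hb' i).2 z hz]
        exact coverProj_interp_mul Γ _ _ _ _)
  refine ⟨{ toContinuousMap := g, map_zero_left := fun z => ?_, map_one_left := fun z => ?_ }⟩
  · rcases c.mem_D_or_E z.2 with hz | ⟨i, hz⟩
    · refine ((hg 0 z).1 hz).trans ?_
      exact (congrArg (coverProj Γ) (CoverGroup.interp_zero _ _)).trans (hF.proj z z.2 hz)
    · refine ((hg 0 z).2 i hz).trans ?_
      exact (congrArg (coverProj Γ) (CoverGroup.interp_zero _ _)).trans ((hG i).proj z z.2 hz)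
  · rcases c.mem_D_or_E z.2 with hz | ⟨i, hz⟩
    · refine ((hg 1 z).1 hz).trans ?_
      exact (congrArg (coverProj Γ) (CoverGroup.interp_one _ _)).trans (hF'.proj z z.2 hz)
    · refine ((hg 1 z).2 i hz).trans ?_
      exact (congrArg (coverProj Γ) (CoverGroup.interp_one _ _)).trans ((hG' i).proj z z.2 hz)

end Crystal


/-! ### Maps with prescribed jumps -/

namespace PlaneCut

variable {m : ℕ} {p : Fin m → Plane} (c : PlaneCut p)

/-- A function that is `1` on the `i`-th cut and vanishes outside the half strip around it. -/
def bump (i : Fin m) (z : Plane) : ℝ :=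
  max 0 ((c.y z - c.y (p i)) - |c.x z - c.x (p i)|) /
    (|c.y z - c.y (p i)| + |c.x z - c.x (p i)|) * max 0 (1 - |c.x z - c.x (p i)| / c.ε)

theorem continuousOn_bump (i : Fin m) : ContinuousOn (c.bump i) (Set.range p)ᶜ := by
  have hx := c.continuous_x
  have hy := c.continuous_y
  refine ContinuousOn.mul (ContinuousOn.div (Continuous.continuousOn (by fun_prop))
    (Continuous.continuousOn (by fun_prop)) fun z hz h => ?_) (Continuous.continuousOn ?_)
  · have h₁ := abs_nonneg (c.y z - c.y (p i))
    have h₂ := abs_nonneg (c.x z - c.x (p i))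
    have h₃ : c.y z - c.y (p i) = 0 := abs_eq_zero.1 (by linarith)
    have h₄ : c.x z - c.x (p i) = 0 := abs_eq_zero.1 (by linarith)
    exact hz ⟨i, (c.ext_xy (sub_eq_zero.1 h₄) (sub_eq_zero.1 h₃)).symm⟩
  · exact continuous_const.max (continuous_const.sub
      (((hx.sub continuous_const).abs).div_const _))

theorem bump_eq_one {i : Fin m} {z : Plane} (hx : c.x z = c.x (p i)) (hy : c.y (p i) < c.y z) :
    c.bump i z = 1 := by
  have h : 0 < c.y z - c.y (p i) := sub_pos.2 hy
  simp only [bump, hx, sub_self, abs_zero, sub_zero, add_zero, zero_div]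
  rw [abs_of_pos h, max_eq_right h.le, div_self h.ne', max_eq_right zero_le_one, one_mul]

theorem bump_eq_zero_of_x {i : Fin m} {z : Plane} (h : c.ε ≤ |c.x z - c.x (p i)|) :
    c.bump i z = 0 := by
  have : 1 - |c.x z - c.x (p i)| / c.ε ≤ 0 := by
    rw [sub_nonpos, le_div_iff₀ c.ε_pos, one_mul]
    exact h
  rw [bump, max_eq_left this, mul_zero]

theorem bump_eq_zero_of_y {i : Fin m} {z : Plane} (h : c.y z ≤ c.y (p i)) : c.bump i z = 0 := by
  have : (c.y z - c.y (p i)) - |c.x z - c.x (p i)| ≤ 0 := by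
    have := abs_nonneg (c.x z - c.x (p i))
    linarith
  rw [bump, max_eq_left this, zero_div, zero_mul]

/-- The part of the bump to the right of the cut. -/
def halfBump (i : Fin m) (z : Plane) : ℝ := if c.x z ≤ c.x (p i) then 0 else c.bump i z

theorem continuousOn_halfBump (i : Fin m) : ContinuousOn (c.halfBump i) c.D := by
  rw [continuousOn_iff_continuous_domRestrict]
  refine Continuous.if_le (f' := fun _ => (0 : ℝ)) (g' := fun z : c.D => c.bump i z) continuous_const
    (continuousOn_iff_continuous_domRestrict.1 ((c.continuousOn_bump i).mono c.D_subset))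
    (c.continuous_x.comp continuous_subtype_val) continuous_const fun z hz => ?_
  exact (c.bump_eq_zero_of_y ((z.2 i).resolve_left (not_not.2 hz)).le).symm

end PlaneCut

/-- The curve `t ↦ (t v, t θ)`. -/
def stdCurve (g : CoverGroup) (t : ℝ) : CoverGroup := CoverGroup.mk' (t • g.vec) (t * g.ang)

theorem stdCurve_one (g : CoverGroup) : stdCurve g 1 = g :=
  CoverGroup.ext' (by simp [stdCurve]) (by simp [stdCurve])

section Crystal

variable {Γ : Subgroup PlaneIsom} {m : ℕ} {p : Fin m → Plane} (c : PlaneCut p)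

theorem exists_map_hasJump (b : Fin m → liftedGroup Γ) :
    ∃ f : C(↥((Set.range p)ᶜ), OrderSpace Γ), HasJump c f b := by
  let F : Plane → CoverGroup := fun z =>
    CoverGroup.mk' (∑ i, c.halfBump i z • (b i).1.vec) (∑ i, c.halfBump i z * (b i).1.ang)
  let G : Fin m → Plane → CoverGroup := fun i z =>
    if c.x z ≤ c.x (p i) then 1 else stdCurve (b i).1 (c.bump i z) * (b i).1⁻¹
  have hF : ContinuousOn F c.D := by
    refine CoverGroup.continuous_mk'.comp_continuousOn (ContinuousOn.prodMk ?_ ?_)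
    · exact continuousOn_finsetSum (f := fun i z => c.halfBump i z • (b i).1.vec) Finset.univ
        fun i _ => (c.continuousOn_halfBump i).smul continuousOn_const
    · exact continuousOn_finsetSum (f := fun i z => c.halfBump i z * (b i).1.ang) Finset.univ
        fun i _ => (c.continuousOn_halfBump i).mul continuousOn_const
  have hG : ∀ i, ContinuousOn (G i) (c.E i) := fun i => by
    rw [continuousOn_iff_continuous_domRestrict]
    have hb := continuousOn_iff_continuous_domRestrict.1
      ((c.continuousOn_bump i).mono (c.E_subset i))
    refine Continuous.if_le (f' := fun _ => (1 : CoverGroup))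
      (g' := fun z : c.E i => stdCurve (b i).1 (c.bump i z) * (b i).1⁻¹) continuous_const
      ?_ (c.continuous_x.comp continuous_subtype_val) continuous_const fun z hz => ?_
    · refine Continuous.mul ?_ continuous_const
      exact CoverGroup.continuous_iff.2 ⟨hb.smul continuous_const, hb.mul continuous_const⟩
    · rw [c.bump_eq_one hz z.2.1, stdCurve_one, mul_inv_cancel]
  have hother : ∀ i z, z ∈ c.E i → ∀ j, j ≠ i → c.halfBump j z = 0 := fun i z hz j hj => by
    rw [PlaneCut.halfBump, c.bump_eq_zero_of_x (c.x_ne_of_E hz hj).le, ite_self]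
  have hFi : ∀ i z, z ∈ c.E i → F z = stdCurve (b i).1 (c.halfBump i z) := fun i z hz => by
    refine CoverGroup.ext' ?_ ?_
    · exact Finset.sum_eq_single i (fun j _ hj => by rw [hother i z hz j hj, zero_smul])
        fun h => absurd (Finset.mem_univ i) h
    · exact Finset.sum_eq_single i (fun j _ hj => by rw [hother i z hz j hj, zero_mul])
        fun h => absurd (Finset.mem_univ i) h
  have hL : ∀ i, ∀ z ∈ c.EL i, F z = G i z := fun i z hz => by
    rw [hFi i z hz.1]
    simp only [G, PlaneCut.halfBump, if_pos hz.2.le]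
    exact CoverGroup.ext' (by simp [stdCurve]) (by simp [stdCurve])
  have hR : ∀ i, ∀ z ∈ c.ER i, F z = G i z * b i := fun i z hz => by
    rw [hFi i z hz.1]
    simp [G, PlaneCut.halfBump, if_neg (not_le.2 hz.2)]
  obtain ⟨g, hg⟩ := c.exists_glue (T := Unit) (fun q => coverProj Γ (F q.2))
    (fun i q => coverProj Γ (G i q.2))
    ((coverProj Γ).continuous.comp_continuousOn (hF.comp continuousOn_snd fun q hq => hq.2))
    (fun i => (coverProj Γ).continuous.comp_continuousOn
      ((hG i).comp continuousOn_snd fun q hq => hq.2))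
    (fun t i z hD hE => by
      rcases mem_EL_or_ER hD hE with hz | hz
      · simp only [hL i z hz]
      · simp only [hR i z hz]
        exact coverProj_mul Γ _ _)
  refine ⟨g.comp ((ContinuousMap.const _ ()).prodMk (ContinuousMap.id _)), F, G,
    ⟨hF, fun z hz hzD => ((hg () ⟨z, hz⟩).1 hzD).symm⟩,
    fun i => ⟨hG i, fun z hz hzE => ((hg () ⟨z, hz⟩).2 i hzE).symm⟩, fun i => ⟨hL i, hR i⟩⟩

/-! ### Loops around the points -/

variable [DiscreteTopology Γ] {c} {f : C(↥((Set.range p)ᶜ), OrderSpace Γ)}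
  {b : Fin m → liftedGroup Γ}

theorem IsLiftOn.lift_eq {U S : Set Plane} {f : C(U, OrderSpace Γ)} {F : Plane → CoverGroup}
    (hF : IsLiftOn f S F) (w : C(I, U)) (P : C(I, CoverGroup))
    (hP : ∀ t, coverProj Γ (P t) = f (w t)) {a d : I} (h : ∀ t ∈ Set.Icc a d, (w t : Plane) ∈ S)
    (γ : liftedGroup Γ) (had : a ≤ d) (ha : P a = F (w a) * γ) : P d = F (w d) * γ := by
  have hF' := hF.mul_right γ
  refine (isCoveringMap_coverProj Γ).eqOn_of_comp_eqOn (s := Set.Icc a d) isPreconnected_Icc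
    P.continuous.continuousOn
    (hF'.continuousOn.comp (continuous_subtype_val.comp w.continuous).continuousOn h)
    (fun t ht => ?_) (Set.left_mem_Icc.2 had) ha (Set.right_mem_Icc.2 had)
  exact (hP t).trans (hF'.proj (w t) (w t).2 (h t ht)).symm

omit [DiscreteTopology Γ] in
theorem PlaneCut.x_circle (i : Fin m) (ρ τ : ℝ) :
    c.x (p i + ρ • !₂[Real.cos τ, Real.sin τ]) - c.x (p i) = ρ * Real.cos (τ - c.α) := by
  rw [c.x_add, c.x_smul, Real.cos_sub]
  simp [PlaneCut.x]
  left
  ring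

omit [DiscreteTopology Γ] in
theorem PlaneCut.y_circle (i : Fin m) (ρ τ : ℝ) :
    c.y (p i + ρ • !₂[Real.cos τ, Real.sin τ]) - c.y (p i) = ρ * Real.sin (τ - c.α) := by
  rw [c.y_add, c.y_smul, Real.sin_sub]
  simp [PlaneCut.y]
  left
  ring

/-- A small circle around a point lifts to a path with the prescribed jump. -/
theorem HasJump.exists_lift_circle (h : HasJump c f b) (i : Fin m) {ρ : ℝ} (h0 : 0 < ρ)
    (hρ : ρ < c.ε) (w : C(I, ↥((Set.range p)ᶜ)))
    (hw : ∀ t : I, (w t : Plane) =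
      p i + ρ • !₂[Real.cos (2 * Real.pi * (t : ℝ)), Real.sin (2 * Real.pi * (t : ℝ))]) :
    ∃ P : C(I, CoverGroup), (∀ t, coverProj Γ (P t) = f (w t)) ∧ P 1 = P 0 * b i := by
  obtain ⟨F, G, hF, hG, hb⟩ := h
  have hα := c.α_pos
  have hα' := c.α_lt
  have hpi := Real.pi_pos
  let t₁ : I := ⟨(Real.pi / 4 + c.α) / (2 * Real.pi), by positivity, by
    rw [div_le_one (by positivity)]
    linarith⟩
  let t₂ : I := ⟨(3 * Real.pi / 4 + c.α) / (2 * Real.pi), by positivity, by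
    rw [div_le_one (by positivity)]
    linarith⟩
  have ht₁ : 2 * Real.pi * (t₁ : ℝ) = Real.pi / 4 + c.α := by
    simp only [t₁]
    field_simp
  have ht₂ : 2 * Real.pi * (t₂ : ℝ) = 3 * Real.pi / 4 + c.α := by
    simp only [t₂]
    field_simp
  have hx : ∀ t : I, c.x (w t) - c.x (p i) = ρ * Real.cos (2 * Real.pi * t - c.α) := fun t => by
    rw [hw, PlaneCut.x_circle]
  have hy : ∀ t : I, c.y (w t) - c.y (p i) = ρ * Real.sin (2 * Real.pi * t - c.α) := fun t => by
    rw [hw, PlaneCut.y_circle]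
  have hxε : ∀ t : I, |c.x (w t) - c.x (p i)| < c.ε := fun t => by
    rw [hx, abs_mul, abs_of_pos h0]
    have := Real.abs_cos_le_one (2 * Real.pi * t - c.α)
    nlinarith
  have hDmem : ∀ t : I, (Real.cos (2 * Real.pi * t - c.α) ≠ 0 ∨
      Real.sin (2 * Real.pi * t - c.α) < 0) → (w t : Plane) ∈ c.D := fun t ht j => by
    by_cases hj : j = i
    · subst hj
      rcases ht with ht | ht
      · left
        rw [← sub_ne_zero, hx]
        exact mul_ne_zero h0.ne' ht
      · right
        rw [← sub_neg, hy]
        exact mul_neg_of_pos_of_neg h0 ht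
    · left
      intro h'
      have h₁ := c.sep_x hj
      have h₂ := hxε t
      rw [h'] at h₂
      linarith
  have hEmem : ∀ t : I, 0 < Real.sin (2 * Real.pi * t - c.α) → (w t : Plane) ∈ c.E i :=
    fun t ht => ⟨by
      rw [← sub_pos, hy]
      exact mul_pos h0 ht, hxε t⟩
  have hle : ∀ {s t : I}, s ≤ t → 2 * Real.pi * (s : ℝ) ≤ 2 * Real.pi * t := fun {s t} hst =>
    mul_le_mul_of_nonneg_left hst (by positivity)
  have hnn : ∀ t : I, 0 ≤ 2 * Real.pi * (t : ℝ) := fun t => mul_nonneg (by positivity) t.2.1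
  have hle1 : ∀ t : I, 2 * Real.pi * (t : ℝ) ≤ 2 * Real.pi := fun t => by
    have := hle (show t ≤ 1 from t.2.2)
    simpa using this
  have h01 : t₁ ≤ t₂ := by
    have : (t₁ : ℝ) ≤ t₂ := by nlinarith
    exact this
  have cos₁ : ∀ t : I, t ≤ t₁ → 0 < Real.cos (2 * Real.pi * t - c.α) := fun t ht => by
    have := hle ht
    have := hnn t
    exact Real.cos_pos_of_mem_Ioo ⟨by linarith, by linarith⟩
  have m₁ : ∀ t ∈ Set.Icc 0 t₁, (w t : Plane) ∈ c.D := fun t ht =>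
    hDmem t (Or.inl (cos₁ t ht.2).ne')
  have m₂ : ∀ t ∈ Set.Icc t₁ t₂, (w t : Plane) ∈ c.E i := fun t ht => by
    have := hle ht.1
    have := hle ht.2
    exact hEmem t (Real.sin_pos_of_pos_of_lt_pi (by linarith) (by linarith))
  have cos₂ : ∀ t : I, t₂ ≤ t → 2 * Real.pi * t - c.α ≤ Real.pi →
      Real.cos (2 * Real.pi * t - c.α) < 0 := fun t ht ht' => by
    have := hle ht
    exact Real.cos_neg_of_pi_div_two_lt_of_lt (by linarith) (by linarith)
  have m₃ : ∀ t ∈ Set.Icc t₂ 1, (w t : Plane) ∈ c.D := fun t ht => by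
    refine hDmem t ?_
    rcases le_or_gt (2 * Real.pi * t - c.α) Real.pi with h' | h'
    · exact Or.inl (cos₂ t ht.1 h').ne
    · right
      have := hle1 t
      have e : Real.sin (2 * Real.pi * t - c.α) =
          -Real.sin (2 * Real.pi * t - c.α - Real.pi) := by
        rw [Real.sin_sub_pi, neg_neg]
      rw [e, neg_lt_zero]
      exact Real.sin_pos_of_pos_of_lt_pi (by linarith) (by linarith)
  have cov := isCoveringMap_coverProj Γ
  have hP0 : (f.comp w) 0 = coverProj Γ (F (w 0)) :=
    (hF.proj (w 0) (w 0).2 (m₁ 0 ⟨le_rfl, t₁.2.1⟩)).symm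
  let P := cov.liftPath (f.comp w) (F (w 0)) hP0
  have hP : ∀ t, coverProj Γ (P t) = f (w t) := congrFun (cov.liftPath_lifts (f.comp w) _ hP0)
  have hP0' : P 0 = F (w 0) := cov.liftPath_zero (f.comp w) _ hP0
  refine ⟨P, hP, ?_⟩
  have e₁ : P t₁ = F (w t₁) * (1 : liftedGroup Γ) :=
    hF.lift_eq w P hP m₁ 1 t₁.2.1 (by simpa using hP0')
  have r₁ : (w t₁ : Plane) ∈ c.ER i := by
    refine ⟨m₂ t₁ ⟨le_rfl, h01⟩, ?_⟩
    rw [← sub_pos, hx]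
    exact mul_pos h0 (cos₁ t₁ le_rfl)
  have e₂ : P t₂ = G i (w t₂) * b i :=
    (hG i).lift_eq w P hP m₂ (b i) h01 (by simpa [(hb i).2 _ r₁] using e₁)
  have r₂ : (w t₂ : Plane) ∈ c.EL i := by
    refine ⟨m₂ t₂ ⟨h01, le_rfl⟩, ?_⟩
    rw [← sub_neg, hx]
    exact mul_neg_of_pos_of_neg h0 (cos₂ t₂ le_rfl (by linarith))
  rw [← (hb i).1 _ r₂] at e₂
  have e₃ : P 1 = F (w 1) * b i := hF.lift_eq w P hP m₃ (b i) t₂.2.2 e₂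
  have hw01 : w 1 = w 0 := Subtype.ext (by simp [hw])
  rw [e₃, hw01, hP0']

theorem HasJump.hasLoopAt (h : HasJump c f b) (i : Fin m) :
    HasLoopAt p i f (crystalLoop Γ (b i) : C(I, OrderSpace Γ)) := by
  intro r h0 hr w hw
  let ρ : ℝ := min r (c.ε / 2)
  have hρ0 : 0 < ρ := lt_min h0 (half_pos c.ε_pos)
  have hρε : ρ < c.ε := (min_le_right _ _).trans_lt (half_lt_self c.ε_pos)
  have hmem : ∀ s t : I, p i + ((1 - (s : ℝ)) * ρ + s * r) •
      !₂[Real.cos (2 * Real.pi * (t : ℝ)), Real.sin (2 * Real.pi * (t : ℝ))] ∈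
        (Set.range p)ᶜ := by
    rintro s t ⟨j, hj⟩
    set R : ℝ := (1 - (s : ℝ)) * ρ + s * r with hR
    have hs0 := s.2.1
    have hs1 := s.2.2
    have hρr : ρ ≤ r := min_le_left _ _
    have hR0 : 0 < R := by nlinarith
    have hRr : R ≤ r := by nlinarith
    have hnorm : ‖(!₂[Real.cos (2 * Real.pi * (t : ℝ)), Real.sin (2 * Real.pi * (t : ℝ))] :
        Plane)‖ = 1 := by
      rw [EuclideanSpace.norm_eq, Fin.sum_univ_two]
      simp
    have hd : dist (p j) (p i) = R := by
      rw [hj, dist_eq_norm, add_sub_cancel_left, norm_smul, hnorm, mul_one, Real.norm_eq_abs,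
        abs_of_pos hR0]
    by_cases hji : j = i
    · subst hji
      rw [dist_self] at hd
      linarith
    · have := hr j hji
      linarith
  have hcont : Continuous fun q : I × I => p i + ((1 - (q.1 : ℝ)) * ρ + q.1 * r) •
      (!₂[Real.cos (2 * Real.pi * (q.2 : ℝ)), Real.sin (2 * Real.pi * (q.2 : ℝ))] : Plane) := by
    have h1 : Continuous fun q : I × I => (1 - (q.1 : ℝ)) * ρ + q.1 * r := by fun_prop
    refine continuous_const.add (h1.smul ?_)
    refine (PiLp.continuous_toLp 2 _).comp (continuous_pi fun j => ?_)
    have h2 : Continuous fun q : I × I => 2 * Real.pi * (q.2 : ℝ) := by fun_prop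
    fin_cases j
    · exact Real.continuous_cos.comp h2
    · exact Real.continuous_sin.comp h2
  let W : C(I × I, ↥((Set.range p)ᶜ)) := ⟨fun q => ⟨_, hmem q.1 q.2⟩, hcont.subtype_mk _⟩
  let w₀ : C(I, ↥((Set.range p)ᶜ)) := W.comp ((ContinuousMap.const _ 0).prodMk (ContinuousMap.id _))
  obtain ⟨P, hP, hP1⟩ := h.exists_lift_circle i hρ0 hρε w₀ (fun t => by simp [w₀, W])
  have cov := isCoveringMap_coverProj Γ
  let H : C(I × I, OrderSpace Γ) := f.comp W
  have H0 : ∀ t, H (0, t) = coverProj Γ (P t) := fun t => (hP t).symm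
  let K := cov.liftHomotopy H P H0
  have hK : ∀ q, coverProj Γ (K q) = H q := congrFun (cov.liftHomotopy_lifts H P H0)
  have hK0 : ∀ t, K (0, t) = P t := cov.liftHomotopy_zero H P H0
  have hW01 : ∀ s, W (s, 0) = W (s, 1) := fun s => Subtype.ext (by simp [W])
  have hKb := cov.eq_of_comp_eq (g₁ := fun s : I => K (s, 1)) (g₂ := fun s : I => K (s, 0) * b i)
    (K.continuous.comp (continuous_id.prodMk continuous_const))
    ((K.continuous.comp (continuous_id.prodMk continuous_const)).mul continuous_const)
    (funext fun s => by
      simp only [Function.comp_apply]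
      rw [coverProj_mul, hK, hK]
      exact congrArg f (hW01 s).symm) 0 (by
      simp only [hK0]
      exact hP1)
  refine freelyHomotopic_crystalLoop Γ _
    (K.comp ((ContinuousMap.const _ 1).prodMk (ContinuousMap.id _))) (fun t => ?_) (b i)
    (congrFun hKb 1)
  refine (hK (1, t)).trans (congrArg f (Subtype.ext ?_))
  rw [hw]
  simp [W]

end Crystal


/-! ### Homotopy classes of maps into a disjoint union -/

section Components

variable {U Y V : Type} [TopologicalSpace U] [TopologicalSpace Y] [TopologicalSpace V]

theorem HTop.mk_eq_mk {f g : C(U, Y)} : HTop.mk f = HTop.mk g ↔ f.Homotopic g :=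
  Quotient.eq (r := homotopySetoid U Y)

theorem HTop.post_mk (j : C(Y, V)) (f : C(U, Y)) : HTop.post j (HTop.mk f) = HTop.mk (j.comp f) :=
  rfl

theorem HTop.exists_rep (q : HTop U Y) : ∃ f, HTop.mk f = q := Quotient.exists_rep q

theorem ContinuousMap.exists_factor {j : C(Y, V)} (hj : Topology.IsOpenEmbedding j) (g : C(U, V))
    (h : ∀ u, g u ∈ Set.range j) : ∃ g' : C(U, Y), ∀ u, j (g' u) = g u := by
  choose g' hg' using h
  refine ⟨⟨g', hj.isInducing.continuous_iff.2 ?_⟩, hg'⟩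
  exact g.continuous.congr fun u => (hg' u).symm

theorem mem_range_of_isClopen {A : Type} [TopologicalSpace A] [PreconnectedSpace A] {s : Set V}
    (hs : IsClopen s) (g : C(A, V)) (a₀ : A) (h₀ : g a₀ ∈ s) (a : A) : g a ∈ s := by
  have h := (hs.preimage g.continuous).eq_univ ⟨a₀, h₀⟩
  exact (h ▸ Set.mem_univ a : a ∈ g ⁻¹' s)

theorem HTop.mem_of_homotopic {s : Set V} (hs : IsClopen s) {f g : C(U, V)} (h : f.Homotopic g)
    {u : U} (hu : f u ∈ s) : g u ∈ s := by
  obtain ⟨K⟩ := h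
  have := mem_range_of_isClopen hs
    (K.toContinuousMap.comp ((ContinuousMap.id I).prodMk (ContinuousMap.const I u))) 0
    (by simpa using hu) 1
  simpa using this

theorem HTop.post_injective {j : C(Y, V)} (hj : Topology.IsOpenEmbedding j) (hc : IsClosed (Set.range j)) :
    Function.Injective (HTop.post j : HTop U Y → HTop U V) := by
  intro q q' h
  obtain ⟨f, rfl⟩ := HTop.exists_rep q
  obtain ⟨f', rfl⟩ := HTop.exists_rep q'
  rw [HTop.post_mk, HTop.post_mk, HTop.mk_eq_mk] at h
  obtain ⟨K⟩ := h
  have hr : ∀ z, K z ∈ Set.range j := fun ⟨t, u⟩ => by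
    have := mem_range_of_isClopen ⟨hc, hj.isOpen_range⟩
      (K.toContinuousMap.comp ((ContinuousMap.id I).prodMk (ContinuousMap.const I u))) 0
      (by simp) t
    simpa using this
  obtain ⟨K', hK'⟩ := ContinuousMap.exists_factor hj K.toContinuousMap hr
  refine HTop.mk_eq_mk.2 ⟨⟨K', fun u => ?_, fun u => ?_⟩⟩
  · exact hj.injective ((hK' (0, u)).trans (K.apply_zero u))
  · exact hj.injective ((hK' (1, u)).trans (K.apply_one u))

theorem HTop.exists_post_eq [PreconnectedSpace U] {j : C(Y, V)} (hj : Topology.IsOpenEmbedding j)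
    (hc : IsClosed (Set.range j)) (f : C(U, V)) (u : U) (hu : f u ∈ Set.range j) :
    ∃ q : HTop U Y, HTop.post j q = HTop.mk f := by
  obtain ⟨f', hf'⟩ := ContinuousMap.exists_factor hj f
    (mem_range_of_isClopen ⟨hc, hj.isOpen_range⟩ f u hu)
  refine ⟨HTop.mk f', ?_⟩
  rw [HTop.post_mk]
  congr 1
  exact ContinuousMap.ext hf'

end Components

/-! ### The two chiralities -/

section Crystal

open PlaneIsom

variable (Γ : Subgroup PlaneIsom)

theorem chiralMap_mk (ε : ZMod 2) (g : properIsom) :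
    chiralMap Γ ε (QuotientGroup.mk g) = QuotientGroup.mk (axisReflection ^ ε.val * g.1) := rfl

theorem isOpen_properIsom : IsOpen (properIsom : Set PlaneIsom) := by
  have hc : Continuous fun g : PlaneIsom => g.right.1.det :=
    (continuous_subtype_val.comp (SemidirectProduct.continuous_right' orthAction)).matrix_det
  have : (properIsom : Set PlaneIsom) = {g | 0 < g.right.1.det} := by
    ext g
    change g.right.1.det = 1 ↔ 0 < g.right.1.det
    rcases det_eq g with h | h <;> rw [h] <;> norm_num
  rw [this]
  exact isOpen_lt continuous_const hc

theorem isOpenEmbedding_chiralMap (ε : ZMod 2) : Topology.IsOpenEmbedding (chiralMap Γ ε) := by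
  refine .of_continuous_injective_isOpenMap (chiralMap Γ ε).continuous ?_ ?_
  · intro a b h
    obtain ⟨a, rfl⟩ := QuotientGroup.mk_surjective a
    obtain ⟨b, rfl⟩ := QuotientGroup.mk_surjective b
    rw [chiralMap_mk, chiralMap_mk, QuotientGroup.eq] at h
    refine QuotientGroup.eq.2 ?_
    rw [Subgroup.mem_subgroupOf]
    simpa [mul_assoc] using h
  · intro O hO
    have h₁ : IsOpen ((fun g : properIsom => axisReflection ^ ε.val * g.1) ''
        ((QuotientGroup.mk : properIsom → OrderSpace Γ) ⁻¹' O)) :=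
      (Homeomorph.mulLeft (axisReflection ^ ε.val)).isOpenMap.comp
        isOpen_properIsom.isOpenMap_subtype_val _ (hO.preimage continuous_quot_mk)
    have h₂ := QuotientGroup.isOpenMap_coe (N := Γ) _ h₁
    convert h₂ using 1
    ext v
    constructor
    · rintro ⟨y, hy, rfl⟩
      obtain ⟨g, rfl⟩ := QuotientGroup.mk_surjective y
      exact ⟨_, ⟨g, hy, rfl⟩, rfl⟩
    · rintro ⟨_, ⟨g, hg, rfl⟩, rfl⟩
      exact ⟨_, hg, rfl⟩

theorem det_axisReflection : axisReflection.right.1.det = -1 := by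
  simp [axisReflection, PlaneIsom.mk', Matrix.det_fin_two]

theorem mk_mem_range_chiralMap_zero {g : PlaneIsom} (h : g.right.1.det = 1) :
    (QuotientGroup.mk g : VacuumSpace Γ) ∈ Set.range (chiralMap Γ 0) :=
  ⟨QuotientGroup.mk ⟨g, h⟩, by rw [chiralMap_mk]; simp⟩

theorem mk_mem_range_chiralMap_one {g : PlaneIsom} (h : g.right.1.det ≠ 1) :
    (QuotientGroup.mk g : VacuumSpace Γ) ∈ Set.range (chiralMap Γ 1) := by
  have hd : (axisReflection⁻¹ * g).right.1.det = 1 := by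
    rw [det_mul, det_inv, det_axisReflection, (det_eq g).resolve_left h]
    norm_num
  refine ⟨QuotientGroup.mk ⟨axisReflection⁻¹ * g, hd⟩, ?_⟩
  rw [chiralMap_mk, ZMod.val_one, pow_one, mul_inv_cancel_left]

theorem chiralMap_zero_surjective (h : HasReflection Γ) :
    Function.Surjective (chiralMap Γ 0) := by
  intro v
  obtain ⟨g, rfl⟩ := QuotientGroup.mk_surjective v
  by_cases hg : g.right.1.det = 1
  · exact mk_mem_range_chiralMap_zero Γ hg
  · obtain ⟨s, hs, hsd⟩ := h
    have hd : (g * s).right.1.det = 1 := by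
      rw [det_mul, hsd, (det_eq g).resolve_left hg]
      norm_num
    have e : (QuotientGroup.mk g : VacuumSpace Γ) = QuotientGroup.mk (g * s) :=
      QuotientGroup.eq.2 (by simpa using hs)
    rw [e]
    exact mk_mem_range_chiralMap_zero Γ hd

theorem range_chiralMap_one (h : ¬ HasReflection Γ) :
    Set.range (chiralMap Γ 1) = (Set.range (chiralMap Γ 0))ᶜ := by
  ext v
  constructor
  · rintro ⟨a, rfl⟩ ⟨b, hb⟩
    obtain ⟨a, rfl⟩ := QuotientGroup.mk_surjective a
    obtain ⟨b, rfl⟩ := QuotientGroup.mk_surjective b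
    rw [chiralMap_mk, chiralMap_mk, QuotientGroup.eq] at hb
    refine h ⟨_, hb, ?_⟩
    have ha : a.1.right.1.det = 1 := a.2
    have hb' : b.1.right.1.det = 1 := b.2
    rw [det_mul, det_inv, ZMod.val_zero, ZMod.val_one, pow_zero, one_mul, pow_one, det_mul, ha,
      hb', det_axisReflection]
    norm_num
  · intro hv
    obtain ⟨g, rfl⟩ := QuotientGroup.mk_surjective v
    by_cases hg : g.right.1.det = 1
    · exact absurd (mk_mem_range_chiralMap_zero Γ hg) hv
    · exact mk_mem_range_chiralMap_one Γ hg

variable {U : Type} [TopologicalSpace U]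

theorem bijective_post_chiralMap_zero (h : HasReflection Γ) [ConnectedSpace U] :
    Function.Bijective (HTop.post (chiralMap Γ 0) : HTop U (OrderSpace Γ) → _) := by
  have hr : Set.range (chiralMap Γ 0) = Set.univ := (chiralMap_zero_surjective Γ h).range_eq
  have hc : IsClosed (Set.range (chiralMap Γ 0)) := by
    rw [hr]
    exact isClosed_univ
  refine ⟨HTop.post_injective (isOpenEmbedding_chiralMap Γ 0) hc, fun q => ?_⟩
  obtain ⟨f, rfl⟩ := HTop.exists_rep q
  obtain ⟨u⟩ : Nonempty U := inferInstance
  exact HTop.exists_post_eq (isOpenEmbedding_chiralMap Γ 0) hc f u (by simp [hr])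

theorem bijective_post_chiralMap (h : ¬ HasReflection Γ) [ConnectedSpace U] :
    Function.Bijective (fun q : HTop U (OrderSpace Γ) × ZMod 2 =>
      HTop.post (chiralMap Γ q.2) q.1) := by
  obtain ⟨u⟩ : Nonempty U := inferInstance
  have hr := range_chiralMap_one Γ h
  have hc₀ : IsClosed (Set.range (chiralMap Γ 0)) := by
    rw [← isOpen_compl_iff, ← hr]
    exact (isOpenEmbedding_chiralMap Γ 1).isOpen_range
  have hc : ∀ ε, IsClosed (Set.range (chiralMap Γ ε)) := fun ε => by
    fin_cases ε
    · exact hc₀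
    · change IsClosed (Set.range (chiralMap Γ 1))
      rw [hr, isClosed_compl_iff]
      exact (isOpenEmbedding_chiralMap Γ 0).isOpen_range
  have hdisj : ∀ (f g : C(U, OrderSpace Γ)),
      ¬ ((chiralMap Γ 0).comp f).Homotopic ((chiralMap Γ 1).comp g) := fun f g hfg => by
    have h₁ := HTop.mem_of_homotopic ⟨hc₀, (isOpenEmbedding_chiralMap Γ 0).isOpen_range⟩ hfg
      (u := u) ⟨f u, rfl⟩
    have h₂ : chiralMap Γ 1 (g u) ∈ Set.range (chiralMap Γ 1) := ⟨_, rfl⟩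
    rw [hr] at h₂
    exact h₂ h₁
  constructor
  · rintro ⟨q, ε⟩ ⟨q', ε'⟩ hq
    have hε : ε = ε' := by
      obtain ⟨f, rfl⟩ := HTop.exists_rep q
      obtain ⟨f', rfl⟩ := HTop.exists_rep q'
      simp only [HTop.post_mk, HTop.mk_eq_mk] at hq
      fin_cases ε <;> fin_cases ε'
      · rfl
      · exact absurd hq (hdisj f f')
      · exact absurd hq.symm (hdisj f' f)
      · rfl
    subst hε
    exact congrArg (·, ε) (HTop.post_injective (isOpenEmbedding_chiralMap Γ ε) (hc ε) hq)
  · intro q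
    obtain ⟨f, rfl⟩ := HTop.exists_rep q
    by_cases hu : f u ∈ Set.range (chiralMap Γ 0)
    · obtain ⟨q, hq⟩ := HTop.exists_post_eq (isOpenEmbedding_chiralMap Γ 0) (hc 0) f u hu
      exact ⟨(q, 0), hq⟩
    · rw [← Set.mem_compl_iff, ← hr] at hu
      obtain ⟨q, hq⟩ := HTop.exists_post_eq (isOpenEmbedding_chiralMap Γ 1) (hc 1) f u hu
      exact ⟨(q, 1), hq⟩

theorem connectedSpace_compl_range {m : ℕ} (p : Fin m → Plane) :
    ConnectedSpace ↥((Set.range p)ᶜ) := by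
  refine isConnected_iff_connectedSpace.1
    ((Set.finite_range p).countable.isConnected_compl_of_one_lt_rank ?_)
  rw [← Module.finrank_eq_rank]
  simp

/-! ### Classification by jumps -/

theorem exists_classification [DiscreteTopology Γ] {H : Type} [Group H] (e : H ≃* liftedGroup Γ)
    {m : ℕ} (p : Fin m → Plane) (hp : Function.Injective p) :
    ∃ Ψ : HTop ↥((Set.range p)ᶜ) (OrderSpace Γ) ≃ Quotient (simConj H m),
      ∀ (f : C(↥((Set.range p)ᶜ), OrderSpace Γ)) (γ : Fin m → H),
        Ψ (HTop.mk f) = Quotient.mk _ γ →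
          ∀ i, HasLoopAt p i f (crystalLoop Γ (e (γ i)) : C(I, OrderSpace Γ)) := by
  obtain ⟨c⟩ := nonempty_planeCut p hp
  have hex : ∀ f : C(↥((Set.range p)ᶜ), OrderSpace Γ), ∃ γ : Fin m → H,
      HasJump c f fun i => e (γ i) := fun f => by
    obtain ⟨b, hb⟩ := exists_hasJump c f
    exact ⟨fun i => e.symm (b i), by simpa using hb⟩
  choose γ hγ using hex
  have key : ∀ (f : C(↥((Set.range p)ᶜ), OrderSpace Γ)) (δ : Fin m → H),
      (Quotient.mk (simConj H m) (γ f) = Quotient.mk _ δ ↔ HasJump c f fun i => e (δ i)) := by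
    intro f δ
    rw [Quotient.eq]
    constructor
    · rintro ⟨h, hh⟩
      have := (hγ f).conj (e h)
      simpa [hh] using this
    · intro hδ
      obtain ⟨g, hg⟩ := (hγ f).exists_conj hδ
      refine ⟨e.symm g, fun i => e.injective ?_⟩
      simp [hg i]
  let ψ : HTop ↥((Set.range p)ᶜ) (OrderSpace Γ) → Quotient (simConj H m) :=
    Quotient.lift (fun f => Quotient.mk _ (γ f))
      fun f f' h => (key f _).2 ((hγ f').of_homotopic (ContinuousMap.Homotopic.symm h))
  have hψ : ∀ f, ψ (HTop.mk f) = Quotient.mk _ (γ f) := fun f => rfl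
  have hbij : Function.Bijective ψ := by
    constructor
    · intro q q' h
      obtain ⟨f, rfl⟩ := HTop.exists_rep q
      obtain ⟨f', rfl⟩ := HTop.exists_rep q'
      rw [hψ, hψ, key] at h
      exact HTop.mk_eq_mk.2 (h.homotopic (hγ f'))
    · intro q
      obtain ⟨δ, rfl⟩ := Quotient.exists_rep q
      obtain ⟨f, hf⟩ := exists_map_hasJump c fun i => e (δ i)
      exact ⟨HTop.mk f, (key f δ).2 hf⟩
  refine ⟨Equiv.ofBijective ψ hbij, fun f δ h i => ?_⟩
  exact ((key f δ).1 h).hasLoopAt i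

end Crystal

/-! ### Counting conjugacy classes -/

theorem nonempty_simConj_equiv {H : Type} [Group H] [Countable H] (ρ : H →* Multiplicative ℤ)
    (hρ : Function.Surjective ρ) (m : ℕ) :
    Nonempty (Quotient (simConj H m) ≃ (Fin m → ConjClasses H)) := by
  rcases m with _ | m
  · have : Unique (Quotient (simConj H 0)) := Unique.mk' _
    exact ⟨Equiv.ofUnique _ _⟩
  · have i₁ : Infinite (Quotient (simConj H (m + 1))) := by
      refine Infinite.of_surjective (β := Multiplicative ℤ)
        (Quotient.lift (fun a => ρ (a 0)) ?_) fun n => ?_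
      · rintro a b ⟨h, hh⟩
        simp [hh]
      · obtain ⟨h, rfl⟩ := hρ n
        exact ⟨Quotient.mk _ fun _ => h, rfl⟩
    have i₂ : Infinite (Fin (m + 1) → ConjClasses H) := by
      refine Infinite.of_surjective (β := Multiplicative ℤ)
        (fun a => Quotient.lift (s := IsConj.setoid H) ρ ?_ (a 0)) fun n => ?_
      · intro a b h
        obtain ⟨c, hc⟩ := isConj_iff.1 h
        rw [← hc]
        simp
      · obtain ⟨h, rfl⟩ := hρ n
        exact ⟨fun _ => ConjClasses.mk h, rfl⟩
    have i₃ : Countable (ConjClasses H) := ConjClasses.mk_surjective.countable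
    exact nonempty_equiv_of_countable

instance (M : GL (Fin 2) ℤ) : Countable (LatticeSemidirect M) := by
  have : Countable (Multiplicative (Fin 2 → ℤ)) := inferInstanceAs (Countable (Fin 2 → ℤ))
  have : Countable (Multiplicative ℤ) := inferInstanceAs (Countable ℤ)
  exact Countable.of_equiv _ SemidirectProduct.equivProd.symm

end
theorem mainTheorem2 (Γ : Subgroup PlaneIsom) [DiscreteTopology Γ] [CompactSpace (PlaneIsom ⧸ Γ)]
    (N : ℕ) (hN : N = Nat.card (rotationGroup Γ)) :
    -- the translations form a lattice of full rank, the rotation group is `ℤ/N`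
    (Nonempty (Module.Basis (Fin 2) ℤ (translationLattice Γ)) ∧
      Submodule.span ℝ (translationLattice Γ : Set Plane) = ⊤ ∧
      N ∈ ({1, 2, 3, 4, 6} : Set ℕ) ∧
      rotationGroup Γ = Subgroup.zpowers (rot (2 * Real.pi / N)) ∧
      -- for a suitable origin `o`, `Γ ∩ (ℝ² ⋊ SO(2)) = 𝔸 ⋊ C`
      ∃ o : Plane, ∀ (v : Plane) (R : O2), R.1.det = 1 →
        (PlaneIsom.mk' v R ∈ Γ ↔
          R ∈ rotationGroup Γ ∧ v - (o - matAct R.1 o) ∈ translationLattice Γ)) ∧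
    -- `ℝ² ⋊ ℝ` is the universal cover of `ℝ² ⋊ SO(2)` and of the order parameter space, and the
    -- projection induces isomorphisms on `π_k` for `k > 1`
    (SimplyConnectedSpace CoverGroup ∧ IsCoveringMap coverHom ∧ IsCoveringMap (coverProj Γ) ∧
      ∀ (k : ℕ) (x : CoverGroup),
        (∃ φ : HomotopyGroup.Pi (k + 2) CoverGroup x ≃*
            HomotopyGroup.Pi (k + 2) (OrderSpace Γ) (coverProj Γ x),
          ∀ l : GenLoop (Fin (k + 2)) CoverGroup x,
            φ (Quotient.mk (GenLoop.Homotopic.setoid _ _) l) =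
              Quotient.mk (GenLoop.Homotopic.setoid _ _) (GenLoop.push (coverProj Γ) l)) ∧
        Nonempty (HomotopyGroup.Pi (k + 2) (OrderSpace Γ) (coverProj Γ x) ≃*
          HomotopyGroup.Pi (k + 2) ℝ x.right.toAdd)) ∧
    ∀ b : Module.Basis (Fin 2) ℤ (translationLattice Γ),
      -- `M` is the matrix of the rotation by `2π/N` in the basis `b`
      ∃ M : GL (Fin 2) ℤ,
        (∀ j, matAct (rot (2 * Real.pi / N)).1 (b j) =
          ∑ i, (M : Matrix (Fin 2) (Fin 2) ℤ) i j • (b i : Plane)) ∧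
        M ^ N = 1 ∧
        -- `ℤ² ⋊_M ℤ` is the preimage of `Γ` in the universal cover, and it is `π₁`
        ∃ e : LatticeSemidirect M ≃* liftedGroup Γ,
          (∀ n : Fin 2 → ℤ, (e (SemidirectProduct.inl (Multiplicative.ofAdd n))).1 =
            CoverGroup.mk' (∑ i, n i • (b i : Plane)) 0) ∧
          (∀ g, (e g).1.right.toAdd = 2 * Real.pi / N * (g.right.toAdd : ℝ)) ∧
          (∃ φ : LatticeSemidirect M ≃* FundamentalGroup (OrderSpace Γ) (coverProj Γ 1),
            ∀ g, φ g = FundamentalGroup.fromPath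
              (Path.Homotopic.Quotient.mk (crystalLoop Γ (e g)))) ∧
          (∀ y : OrderSpace Γ,
            Nonempty (FundamentalGroup (OrderSpace Γ) y ≃* LatticeSemidirect M)) ∧
          -- classification of the defects at `m` points
          ∀ (m : ℕ) (p : Fin m → Plane), Function.Injective p →
            (HasReflection Γ →
              Nonempty (Defects Γ (Set.range p) ≃ (Fin m → ConjClasses (LatticeSemidirect M))) ∧
              Function.Bijective (fun q : HTop ↥((Set.range p)ᶜ) (OrderSpace Γ) =>
                (HTop.post (chiralMap Γ 0) q : Defects Γ (Set.range p)))) ∧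
            (¬ HasReflection Γ →
              Nonempty (Defects Γ (Set.range p) ≃
                (Fin m → ConjClasses (LatticeSemidirect M)) × ZMod 2) ∧
              Function.Bijective (fun q : HTop ↥((Set.range p)ᶜ) (OrderSpace Γ) × ZMod 2 =>
                (HTop.post (chiralMap Γ q.2) q.1 : Defects Γ (Set.range p)))) ∧
            ∃ Ψ : HTop ↥((Set.range p)ᶜ) (OrderSpace Γ) ≃
                Quotient (simConj (LatticeSemidirect M) m),
              ∀ (f : C(↥((Set.range p)ᶜ), OrderSpace Γ)) (γ : Fin m → LatticeSemidirect M),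
                Ψ (HTop.mk f) = Quotient.mk _ γ →
                  ∀ i, HasLoopAt p i f (crystalLoop Γ (e (γ i)) : C(I, OrderSpace Γ)) := by
  obtain ⟨o, -, ho⟩ := exists_origin Γ N hN
  refine ⟨⟨nonempty_lattice_basis Γ, latticeSpan_eq_top Γ, rotationGroup_card_mem Γ N hN,
    (rotationGroup_structure Γ N hN).2.2, o, ho⟩,
    ⟨SimplyConnectedSpace.ofContractible _, isCoveringMap_coverHom, isCoveringMap_coverProj Γ,
      homotopyGroup_coverProj Γ⟩, fun b => ?_⟩
  obtain ⟨M, hM, hMN, e, he₁, he₂⟩ := exists_latticeSemidirect_equiv Γ N hN b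
  have hpc := pathConnectedSpace_orderSpace Γ
  refine ⟨M, hM, hMN, e, he₁, he₂, ⟨e.trans (loopClassEquiv Γ), fun g => rfl⟩, fun y =>
    ⟨(FundamentalGroup.fundamentalGroupMulEquivOfPathConnected y (coverProj Γ 1)).trans
      (e.trans (loopClassEquiv Γ)).symm⟩, fun m p hp => ?_⟩
  have hconn := connectedSpace_compl_range p
  obtain ⟨Ψ, hΨ⟩ := exists_classification Γ e p hp
  obtain ⟨κ⟩ := nonempty_simConj_equiv (H := LatticeSemidirect M) SemidirectProduct.rightHom
    SemidirectProduct.rightHom_surjective m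
  refine ⟨fun h => ?_, fun h => ?_, Ψ, hΨ⟩
  · have hb := bijective_post_chiralMap_zero Γ (U := ↥((Set.range p)ᶜ)) h
    exact ⟨⟨(Equiv.ofBijective _ hb).symm.trans (Ψ.trans κ)⟩, hb⟩
  · have hb := bijective_post_chiralMap Γ (U := ↥((Set.range p)ᶜ)) h
    exact ⟨⟨(Equiv.ofBijective _ hb).symm.trans ((Ψ.trans κ).prodCongr (Equiv.refl _))⟩, hb⟩
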